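/- **Setting.** Let $M=(\mathcal S,\mathcal A,H,\{P_h\},\{r_h\})$ be a Markov decision process with steps $h=0,\dots,H-1$, measurable state space $\mathcal S$, finite action set $\mathcal A$, fixed initial state, transition kernels $P_h(\cdot\mid s,a)$ and rewards $r_h(s,a)\in[0,1]$. Let $\gamma\in[0,1]$. The agent's value functions and policy are given by the backward recursion $V_H=0$, $$Q_h(s,a)=r_h(s,a)+\gamma\int V_{h+1}\,dP_h(\cdot\mid s,a),\qquad \pi_h(a\mid s)=\frac{e^{Q_h(s,a)}}{\sum_{a'}e^{Q_h(s,a')}},\qquad V_h(s)=\sum_a\pi_h(a\mid s)Q_h(s,a).$$ Let $d\ge1$, $\Theta\subseteq\mathbb R^d$, and let $\phi:\mathcal S\times\mathcal A\to\mathbb R^d$ be a measurable feature map. Assume: 1. (linear model class) $\phi(s,a_0)=0$ for all $s$, for some fixed $a_0\in\mathcal A$; $\phi(s,a)^\top\theta\in[0,H]$ for all $\theta\in\Theta$ and all $(s,a)$; and for every $h$ there are $\theta_h,w_h\in\Theta$ with $Q_h=\phi^\top\theta_h$ and $r_h=\phi^\top w_h$; 2. (regularity) $\|\theta\|_2\le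 H\sqrt d$ for $\theta\in\Theta$; $\|w_h\|_2\le\sqrt d$; $\|\phi(s,a)\|_2\le1$ for all $(s,a)$; and $\log N(\Theta,\|\cdot\|_\infty,1/n)\le c\,d\log n$, where $n\ge1$ is the number of trajectories observed, $N$ is the covering number and $c$ is a constant. Observe $n$ independent trajectories $(s_h^i,a_h^i)_{0\le h<H}$, $i=1,\dots,n$, of the agent in $M$ under $\pi$ (states and actions only). For each $h<H$ let $\widehat\theta_h$ be a maximizer over $\theta\in\Theta$ of $$\frac1n\sum_{i=1}^n\Big(\phi(s_h^i,a_h^i)^\top\theta-\log\sum_{a'}e^{\phi(s_h^i,a')^\top\theta}\Big),$$ and put $\widehat Q_h=\phi^\top\widehat\theta_h$, $\widehat\pi_h\propto e^{\widehat Q_h}$, $\widehat V_h(s)=\sum_a\widehat\pi_h(a\mid s)\widehat Q_h(s,a)$ and $\widehat V_H=0$. For $\lambda>0$ let $\widehat w_h$ be the minimizer over $w\in\mathbb R^d$ of $$\sum_{i=1}^n\big(\phi(s_h^i,a_h^i)^\top w+\gamma\widehat V_{h+1}(s_{h+1}^i)-\widehat Q_h(s_h^i,a_h^i)\big)^2+\lambda\|w\|_2^2,$$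 and put $\widehat r_h=\phi^\top\widehat w_h$ and $\Lambda_h=\sum_{i=1}^n\phi(s_h^i,a_h^i)\phi(s_h^i,a_h^i)^\top$. Write $\|x\|_B=\sqrt{x^\top Bx}$. **Theorem 2.** There is a constant $C>0$, depending only on $c$, such that for every $\delta\in(0,1)$, with probability at least $1-\delta$, simultaneously for all $h<H$, all $\lambda>0$ and all $(s,a)\in\mathcal S\times\mathcal A$ (and for every choice of the maximizers $\widehat\theta_h$), $$|r_h(s,a)-\widehat r_h(s,a)|\le\|\phi(s,a)\|_{(\Lambda_h+\lambda I)^{-1}}\cdot C\Big(\sqrt{\lambda d}+(1+\gamma)\,He^H\,|\mathcal A|\,d\,\sqrt{\log\tfrac{nH}{\lambda\delta}}\Big),$$ where the last square root is read as $0$ when $\lambda\delta\ge nH$. -/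

import Mathlib

open MeasureTheory ProbabilityTheory
open scoped BigOperators NNReal ENNReal Matrix

noncomputable section

/-- A finite-horizon Markov decision process with fixed initial state. The steps are
`0, …, horizon - 1`; `trans h (s, a)` is the law of the state at step `h + 1` given that action `a`
is taken in state `s` at step `h`; rewards lie in `[0, 1]`. -/
structure MDP (S A : Type*) [MeasurableSpace S] [MeasurableSpace A] where
  horizon : ℕ
  init : S
  trans : ℕ → Kernel (S × A) S
  isMarkov : ∀ h, IsMarkovKernel (trans h)
  reward : ℕ → S → A → ℝ
  reward_mem : ∀ h, h < horizon → ∀ s a, reward h s a ∈ Set.Icc (0 : ℝ) 1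

/-- Softmax (multinomial logit) choice probabilities of the action values `q`. -/
def softmax {A : Type*} [Fintype A] (q : A → ℝ) (a : A) : ℝ :=
  Real.exp (q a) / ∑ b, Real.exp (q b)

/-- The average of the action values `q` under the softmax choice probabilities of `q`. -/
def softmaxValue {A : Type*} [Fintype A] (q : A → ℝ) : ℝ :=
  ∑ a, softmax q a * q a

namespace MDP

variable {S A : Type*} [MeasurableSpace S] [MeasurableSpace A] [Fintype A]

/-- Backward recursion for the value of the dynamic discrete choice agent with discount `γ`:
`valueToGo k h s` is its value in state `s` at step `h` when `k` steps remain. -/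
def valueToGo (M : MDP S A) (γ : ℝ) : ℕ → ℕ → S → ℝ
  | 0, _ => fun _ => 0
  | k + 1, h => fun s =>
      softmaxValue fun a =>
        M.reward h s a + γ * ∫ s', valueToGo M γ k (h + 1) s' ∂(M.trans h (s, a))

/-- The agent's state value function `V_h`; it vanishes at `h = horizon`. -/
def agentV (M : MDP S A) (γ : ℝ) (h : ℕ) : S → ℝ :=
  M.valueToGo γ (M.horizon - h) h

/-- The agent's action value function `Q_h = r_h + γ ⬝ P_h V_{h+1}`. -/
def agentQ (M : MDP S A) (γ : ℝ) (h : ℕ) (s : S) (a : A) : ℝ :=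
  M.reward h s a + γ * ∫ s', M.agentV γ (h + 1) s' ∂(M.trans h (s, a))

/-- The agent's (behavior) policy: softmax of its own action values. -/
def behaviorPolicy (M : MDP S A) (γ : ℝ) (h : ℕ) (s : S) (a : A) : ℝ :=
  softmax (M.agentQ γ h s) a

/-- The discounted Bellman equation `V_h = ⟨π_h, Q_h⟩` holds at every step before the horizon. -/
theorem agentV_eq (M : MDP S A) (γ : ℝ) {h : ℕ} (hh : h < M.horizon) (s : S) :
    M.agentV γ h s = ∑ a, M.behaviorPolicy γ h s a * M.agentQ γ h s a := by
  obtain ⟨k, hk⟩ : ∃ k, M.horizon - h = k + 1 := ⟨M.horizon - h - 1, by omega⟩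
  have hk' : M.horizon - (h + 1) = k := by omega
  have hq : M.agentQ γ h s = fun a =>
      M.reward h s a + γ * ∫ s', M.valueToGo γ k (h + 1) s' ∂(M.trans h (s, a)) := by
    funext a
    simp only [agentQ, agentV, hk']
  simp only [agentV, behaviorPolicy, hq, hk, valueToGo, softmaxValue]

/-- After the last step the value is zero. -/
theorem agentV_horizon (M : MDP S A) (γ : ℝ) (s : S) : M.agentV γ M.horizon s = 0 := by
  simp [agentV, valueToGo]

end MDP

/-- The state-action pairs of a trajectory at the steps `0, …, h - 1`. -/
def past {Ω S A : Type*} (s : ℕ → Ω → S) (a : ℕ → Ω → A) (h : ℕ) (ω : Ω) : Fin h → S × A :=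
  fun j => (s j ω, a j ω)

/-- The random state-action sequence `(s 0, a 0, …, s (H-1), a (H-1))` is a trajectory of the MDP
under the behavior policy: it starts in the initial state; given the past and the current state, the
action is drawn from the behavior policy; given the past up to and including the current action,
the next state is drawn from the transition kernel. -/
structure IsBehaviorTrajectory {Ω S A : Type*} [MeasurableSpace Ω] [MeasurableSpace S]
    [MeasurableSpace A] [Fintype A] (M : MDP S A) (γ : ℝ) (μ : Measure Ω)
    (s : ℕ → Ω → S) (a : ℕ → Ω → A) : Prop where
  measurable_state : ∀ h, h < M.horizon → Measurable (s h)
  measurable_action : ∀ h, h < M.horizon → Measurable (a h)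
  init : ∀ᵐ ω ∂μ, s 0 ω = M.init
  action : ∀ h, h < M.horizon → ∀ x : A, ∀ B : Set ((Fin h → S × A) × S), MeasurableSet B →
    μ {ω | (past s a h ω, s h ω) ∈ B ∧ a h ω = x} =
      ∫⁻ ω in {ω | (past s a h ω, s h ω) ∈ B}, ENNReal.ofReal (M.behaviorPolicy γ h (s h ω) x) ∂μ
  trans : ∀ h, h + 1 < M.horizon → ∀ B : Set (Fin (h + 1) → S × A), MeasurableSet B →
    ∀ C : Set S, MeasurableSet C →
    μ {ω | past s a (h + 1) ω ∈ B ∧ s (h + 1) ω ∈ C} =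
      ∫⁻ ω in {ω | past s a (h + 1) ω ∈ B}, M.trans h (s h ω, a h ω) C ∂μ

/-- The linear function with parameter `θ` and feature `φ`. -/
def linFun {S A : Type*} {d : ℕ} (φ : S → A → EuclideanSpace ℝ (Fin d))
    (θ : EuclideanSpace ℝ (Fin d)) (s : S) (a : A) : ℝ :=
  inner ℝ (φ s a) θ

/-- The average log-likelihood of the choice data `(s i, a i)`, `i < n`, in the linear softmax
model. -/
def logLik {S A : Type*} [Fintype A] {d n : ℕ} (φ : S → A → EuclideanSpace ℝ (Fin d))
    (s : Fin n → S) (a : Fin n → A) (θ : EuclideanSpace ℝ (Fin d)) : ℝ :=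
  (1 / (n : ℝ)) * ∑ i, (linFun φ θ (s i) (a i) - Real.log (∑ b, Real.exp (linFun φ θ (s i) b)))

/-- `θ` is a maximum likelihood estimate over the parameter set `Θ`. -/
def IsMLE {S A : Type*} [Fintype A] {d n : ℕ} (φ : S → A → EuclideanSpace ℝ (Fin d))
    (Θ : Set (EuclideanSpace ℝ (Fin d))) (s : Fin n → S) (a : Fin n → A)
    (θ : EuclideanSpace ℝ (Fin d)) : Prop :=
  θ ∈ Θ ∧ IsMaxOn (logLik φ s a) Θ θ

/-- The estimated state value function at step `h` for horizon `H`, from estimated parameters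
`θ 0, …, θ (H-1)` of the action values; it is zero after the last step. -/
def estV {S A : Type*} [Fintype A] {d : ℕ} (H : ℕ) (φ : S → A → EuclideanSpace ℝ (Fin d))
    (θ : ℕ → EuclideanSpace ℝ (Fin d)) (h : ℕ) (s : S) : ℝ :=
  if h < H then softmaxValue (linFun φ (θ h) s) else 0

/-- The penalized Bellman squared error at step `h`, on the data `(s i, a i)` with next states
`s' i`, as a function of the reward parameter `w`. -/
def bellmanLoss {S A : Type*} [Fintype A] {d n : ℕ} (H : ℕ) (γ lam : ℝ)
    (φ : S → A → EuclideanSpace ℝ (Fin d)) (θ : ℕ → EuclideanSpace ℝ (Fin d)) (h : ℕ)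
    (s : Fin n → S) (a : Fin n → A) (s' : Fin n → S) (w : EuclideanSpace ℝ (Fin d)) : ℝ :=
  ∑ i, (linFun φ w (s i) (a i) + γ * estV H φ θ (h + 1) (s' i) - linFun φ (θ h) (s i) (a i)) ^ 2
    + lam * ‖w‖ ^ 2

/-- The empirical second moment matrix `∑ i, φ(s i, a i) φ(s i, a i)ᵀ`. -/
def gramMatrix {S A : Type*} {d n : ℕ} (φ : S → A → EuclideanSpace ℝ (Fin d))
    (s : Fin n → S) (a : Fin n → A) : Matrix (Fin d) (Fin d) ℝ :=
  ∑ i, Matrix.vecMulVec (φ (s i) (a i)).ofLp (φ (s i) (a i)).ofLp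

/-- The norm `‖x‖_B = √(xᵀ B x)` given by a positive semidefinite matrix `B`. -/
def matNorm {d : ℕ} (B : Matrix (Fin d) (Fin d) ℝ) (x : EuclideanSpace ℝ (Fin d)) : ℝ :=
  Real.sqrt (x.ofLp ⬝ᵥ (B *ᵥ x.ofLp))

/-- `log N(Θ, ‖·‖_∞, ε) ≤ b` for the covering number of `Θ ⊆ ℝ^d` in the sup norm: finitely many
sup-norm balls of radius `ε` cover `Θ`, and the logarithm of their number is at most `b`. -/
def LogCoverLE {d : ℕ} (Θ : Set (EuclideanSpace ℝ (Fin d))) (ε : ℝ≥0) (b : ℝ) : Prop :=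
  ∃ N : ℕ, Metric.externalCoveringNumber ε
    ((fun θ : EuclideanSpace ℝ (Fin d) => (θ.ofLp : Fin d → ℝ)) '' Θ) ≤ (N : ℕ∞) ∧
    Real.log N ≤ b

end

/-!
Reward estimation for a softmax agent with linear action values, from observed choices.

With `Δ = what - w` and the energy `E(u) = ∑ i, ⟪φ i, u⟫ ^ 2 + lam ‖u‖ ^ 2`, the Cauchy-Schwarz
inequality gives `|⟪φ(x, y), Δ⟫| ≤ ‖φ(x, y)‖_{(Λ + lam I)⁻¹} √E(Δ)`, and the first order condition
of ridge regression bounds `√E(Δ)` by `√lam ‖w‖` plus the norm, dual to `√E`, of the functional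
`u ↦ ∑ i, ε i ⟪φ i, u⟫`, where `ε i` is the difference between the regression response and the
reward (`abs_inner_sub_le_of_isMinOn`). The residual is
`ε = (Qhat - Q) - γ (Vhat - V) - γ (V - P V)`, at the observed states and actions.

The first two parts only enter through their `ℓ²` norm over the sample. For a fixed alternative `q`,
the likelihood ratio `√(π_q / π)` times `exp (squared Hellinger distance)` has conditional
expectation at most one, so by Markov's inequality and a union bound over a finite cover of the
parameter set, the sum of the squared Hellinger distances at the observed states is controlled by
the log-likelihood ratio, hence small at the maximum likelihood estimate
(`measure_likelihood_ratio_le`, `IsMLE.exists_sum_sq_le`). Since the reference action has value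
zero and all choice probabilities are at least `1 / (|A| e ^ H)`, Hellinger distance controls the
difference of the action values for all actions at once (`sq_sub_le_one_sub_softmaxAffinity`), and
the softmax value is Lipschitz in the action values (`abs_softmaxValue_sub_le`).

The third part is noise, independent and bounded given the observed states and actions of the step.
Only its component in the range of the design matters, a space of dimension at most `d`; Hoeffding's
inequality along an orthonormal basis of that range bounds it, by a quantity that does not depend
on `lam` (`measure_exists_noise_gt_le`, `measure_noiseEvent_le`). This is why one event serves all
`lam > 0`.

The bound has `log (n H / (lam δ))` in place of `log n`. If `lam` is at least of the order of `n H`,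
the residuals are handled by their size alone; for smaller `lam` the entropy `d log n` of the cover
is absorbed by `lam d` and by the logarithmic term together (`entropy_term_le`).
-/

/-! ### Softmax choice probabilities -/

section Softmax

variable {A : Type*} [Fintype A]

theorem sum_exp_pos [Nonempty A] (q : A → ℝ) : 0 < ∑ b, Real.exp (q b) :=
  Finset.sum_pos (fun _ _ => Real.exp_pos _) Finset.univ_nonempty

theorem softmax_pos (q : A → ℝ) (a : A) : 0 < softmax q a :=
  have : Nonempty A := ⟨a⟩
  div_pos (Real.exp_pos _) (sum_exp_pos q)

theorem sum_softmax [Nonempty A] (q : A → ℝ) : ∑ a, softmax q a = 1 := by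
  simp only [softmax]
  rw [← Finset.sum_div, div_self (sum_exp_pos q).ne']

theorem log_softmax (q : A → ℝ) (a : A) :
    Real.log (softmax q a) = q a - Real.log (∑ b, Real.exp (q b)) := by
  have : Nonempty A := ⟨a⟩
  rw [softmax, Real.log_div (Real.exp_pos _).ne' (sum_exp_pos q).ne', Real.log_exp]

theorem inv_card_mul_exp_le_softmax {q : A → ℝ} {H : ℝ} (hq : ∀ a, q a ∈ Set.Icc 0 H) (a : A) :
    1 / (Fintype.card A * Real.exp H) ≤ softmax q a := by
  have : Nonempty A := ⟨a⟩
  refine div_le_div₀ (Real.exp_pos _).le (Real.one_le_exp (hq a).1) (sum_exp_pos q) ?_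
  calc ∑ b, Real.exp (q b) ≤ ∑ _b : A, Real.exp H :=
        Finset.sum_le_sum fun b _ => Real.exp_le_exp.2 (hq b).2
    _ = Fintype.card A * Real.exp H := by simp

theorem softmaxValue_mem_Icc {q : A → ℝ} {H : ℝ} (hq : ∀ a, q a ∈ Set.Icc 0 H) (hH : 0 ≤ H) :
    softmaxValue q ∈ Set.Icc 0 H := by
  refine ⟨Finset.sum_nonneg fun a _ => mul_nonneg (softmax_pos q a).le (hq a).1, ?_⟩
  cases isEmpty_or_nonempty A
  · simpa [softmaxValue] using hH
  calc softmaxValue q ≤ ∑ a, softmax q a * H :=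
        Finset.sum_le_sum fun a _ => mul_le_mul_of_nonneg_left (hq a).2 (softmax_pos q a).le
    _ = H := by rw [← Finset.sum_mul, sum_softmax, one_mul]

theorem abs_log_softmax_sub_le {p q : A → ℝ} {D : ℝ} (h : ∀ a, |q a - p a| ≤ D) (a : A) :
    |Real.log (softmax q a) - Real.log (softmax p a)| ≤ 2 * D := by
  have : Nonempty A := ⟨a⟩
  have key : ∀ p q : A → ℝ, (∀ a, |q a - p a| ≤ D) →
      Real.log (∑ b, Real.exp (q b)) ≤ D + Real.log (∑ b, Real.exp (p b)) := by
    intro p q h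
    rw [← Real.log_exp D, ← Real.log_mul (Real.exp_pos _).ne' (sum_exp_pos p).ne']
    refine Real.log_le_log (sum_exp_pos q) ?_
    rw [Finset.mul_sum]
    refine Finset.sum_le_sum fun b _ => ?_
    rw [← Real.exp_add]
    exact Real.exp_le_exp.2 (by linarith [(abs_le.1 (h b)).2])
  have h1 := key p q h
  have h2 := key q p fun a => by rw [abs_sub_comm]; exact h a
  rw [log_softmax, log_softmax]
  have h3 := abs_le.1 (h a)
  rw [abs_le]
  constructor <;> linarith [h3.1, h3.2]

theorem sum_abs_softmax_sub_le [Nonempty A] {p q : A → ℝ} {D : ℝ} (h : ∀ a, |q a - p a| ≤ D) :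
    ∑ a, |softmax q a - softmax p a| ≤ 4 * D := by
  have hD : 0 ≤ D := (abs_nonneg _).trans (h (Classical.arbitrary A))
  rcases le_or_gt (1 / 2) D with hD2 | hD2
  · calc ∑ a, |softmax q a - softmax p a| ≤ ∑ a, (softmax q a + softmax p a) := by
          refine Finset.sum_le_sum fun a _ => ?_
          rw [abs_le]
          constructor <;> linarith [softmax_pos q a, softmax_pos p a]
      _ = 2 := by rw [Finset.sum_add_distrib, sum_softmax, sum_softmax]; norm_num
      _ ≤ 4 * D := by linarith
  · calc ∑ a, |softmax q a - softmax p a| ≤ ∑ a, softmax p a * (4 * D) := by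
          refine Finset.sum_le_sum fun a _ => ?_
          have hx := abs_log_softmax_sub_le h a
          set x := Real.log (softmax q a) - Real.log (softmax p a) with hxdef
          have hq : softmax q a = softmax p a * Real.exp x := by
            rw [hxdef, Real.exp_sub, Real.exp_log (softmax_pos _ _), Real.exp_log (softmax_pos _ _),
              mul_div_cancel₀ _ (softmax_pos p a).ne']
          have h1 : |Real.exp x - 1| ≤ 2 * |x| := Real.abs_exp_sub_one_le (by linarith)
          rw [hq, show softmax p a * Real.exp x - softmax p a = softmax p a * (Real.exp x - 1) by ring,
            abs_mul, abs_of_pos (softmax_pos p a)]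
          exact mul_le_mul_of_nonneg_left (by linarith) (softmax_pos p a).le
      _ = 4 * D := by rw [← Finset.sum_mul, sum_softmax, one_mul]

theorem abs_softmaxValue_sub_le {p q : A → ℝ} {H D : ℝ} (hp : ∀ a, p a ∈ Set.Icc 0 H)
    (hD : 0 ≤ D) (hH : 0 ≤ H) (h : ∀ a, |q a - p a| ≤ D) :
    |softmaxValue q - softmaxValue p| ≤ (1 + 4 * H) * D := by
  cases isEmpty_or_nonempty A
  · simp only [softmaxValue, Finset.univ_eq_empty, Finset.sum_empty, sub_self, abs_zero]
    positivity
  have : softmaxValue q - softmaxValue p =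
      ∑ a, softmax q a * (q a - p a) + ∑ a, (softmax q a - softmax p a) * p a := by
    simp only [softmaxValue]
    rw [← Finset.sum_sub_distrib, ← Finset.sum_add_distrib]
    exact Finset.sum_congr rfl fun a _ => by ring
  rw [this]
  have h1 : |∑ a, softmax q a * (q a - p a)| ≤ D := by
    calc _ ≤ ∑ a, |softmax q a * (q a - p a)| := Finset.abs_sum_le_sum_abs _ _
      _ ≤ ∑ a, softmax q a * D := Finset.sum_le_sum fun a _ => by
          rw [abs_mul, abs_of_pos (softmax_pos q a)]
          exact mul_le_mul_of_nonneg_left (h a) (softmax_pos q a).le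
      _ = D := by rw [← Finset.sum_mul, sum_softmax, one_mul]
  have h2 : |∑ a, (softmax q a - softmax p a) * p a| ≤ 4 * D * H := by
    calc _ ≤ ∑ a, |(softmax q a - softmax p a) * p a| := Finset.abs_sum_le_sum_abs _ _
      _ ≤ ∑ a, |softmax q a - softmax p a| * H := Finset.sum_le_sum fun a _ => by
          rw [abs_mul, abs_of_nonneg (hp a).1]
          exact mul_le_mul_of_nonneg_left (hp a).2 (abs_nonneg _)
      _ ≤ 4 * D * H := by
          rw [← Finset.sum_mul]
          exact mul_le_mul_of_nonneg_right (sum_abs_softmax_sub_le h) hH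
  linarith [abs_add_le (∑ a, softmax q a * (q a - p a)) (∑ a, (softmax q a - softmax p a) * p a)]

/-- The Bhattacharyya affinity `∑ a, √(π_p(a) π_q(a))` of the softmax distributions of `p` and `q`;
`1 - softmaxAffinity p q` is their squared Hellinger distance. -/
noncomputable def softmaxAffinity (p q : A → ℝ) : ℝ :=
  ∑ a, Real.sqrt (softmax p a) * Real.sqrt (softmax q a)

theorem sum_sq_sqrt_softmax_sub [Nonempty A] (p q : A → ℝ) :
    ∑ a, (Real.sqrt (softmax p a) - Real.sqrt (softmax q a)) ^ 2 =
      2 * (1 - softmaxAffinity p q) := by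
  have : ∀ a, (Real.sqrt (softmax p a) - Real.sqrt (softmax q a)) ^ 2 =
      softmax p a + softmax q a - 2 * (Real.sqrt (softmax p a) * Real.sqrt (softmax q a)) := by
    intro a
    have h1 := Real.sq_sqrt (softmax_pos p a).le
    have h2 := Real.sq_sqrt (softmax_pos q a).le
    linear_combination h1 + h2
  simp only [this, Finset.sum_sub_distrib, Finset.sum_add_distrib, sum_softmax, ← Finset.mul_sum,
    softmaxAffinity]
  ring

theorem one_sub_softmaxAffinity_nonneg [Nonempty A] (p q : A → ℝ) : 0 ≤ 1 - softmaxAffinity p q := by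
  have := sum_sq_sqrt_softmax_sub p q
  have h : 0 ≤ ∑ a, (Real.sqrt (softmax p a) - Real.sqrt (softmax q a)) ^ 2 :=
    Finset.sum_nonneg fun a _ => sq_nonneg _
  linarith

theorem sq_log_sub_log_le {x y m : ℝ} (hm : 0 < m) (hx : m ≤ x) (hy : m ≤ y) :
    (Real.log x - Real.log y) ^ 2 ≤ 4 / m * (Real.sqrt x - Real.sqrt y) ^ 2 := by
  wlog hxy : y ≤ x generalizing x y
  · have := this hy hx (le_of_not_ge hxy)
    rw [show (Real.log x - Real.log y) ^ 2 = (Real.log y - Real.log x) ^ 2 by ring,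
      show (Real.sqrt x - Real.sqrt y) ^ 2 = (Real.sqrt y - Real.sqrt x) ^ 2 by ring]
    exact this
  have hy0 : 0 < y := hm.trans_le hy
  have hx0 : 0 < x := hm.trans_le hx
  have hsy := Real.sqrt_pos.2 hy0
  have hsx := Real.sqrt_pos.2 hx0
  have h0 : 0 ≤ Real.log x - Real.log y := sub_nonneg.2 (Real.log_le_log hy0 hxy)
  have hs : Real.sqrt y ≤ Real.sqrt x := Real.sqrt_le_sqrt hxy
  have h1 : Real.log x - Real.log y ≤ 2 * ((Real.sqrt x - Real.sqrt y) / Real.sqrt y) := by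
    have := Real.log_le_sub_one_of_pos (div_pos hsx hsy)
    rw [Real.log_div hsx.ne' hsy.ne', Real.log_sqrt hx0.le, Real.log_sqrt hy0.le] at this
    rw [sub_div, div_self hsy.ne']
    linarith
  calc (Real.log x - Real.log y) ^ 2 ≤ (2 * ((Real.sqrt x - Real.sqrt y) / Real.sqrt y)) ^ 2 :=
        pow_le_pow_left₀ h0 h1 2
    _ = 4 / y * (Real.sqrt x - Real.sqrt y) ^ 2 := by
        rw [mul_pow, div_pow, Real.sq_sqrt hy0.le]; ring
    _ ≤ 4 / m * (Real.sqrt x - Real.sqrt y) ^ 2 :=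
        mul_le_mul_of_nonneg_right (div_le_div_of_nonneg_left (by norm_num) hm hy) (sq_nonneg _)

/-- Choice probabilities identify the action values once the value of one action is normalized to
zero, and since they are bounded below by `1 / (|A| e ^ H)` this identification is stable. -/
theorem sq_sub_le_one_sub_softmaxAffinity {p q : A → ℝ} {H : ℝ} (hp : ∀ a, p a ∈ Set.Icc 0 H)
    (hq : ∀ a, q a ∈ Set.Icc 0 H) {a₀ : A} (hp0 : p a₀ = 0) (hq0 : q a₀ = 0) (a : A) :
    (q a - p a) ^ 2 ≤ 32 * (Fintype.card A * Real.exp H) * (1 - softmaxAffinity p q) := by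
  have : Nonempty A := ⟨a⟩
  have hK : 0 < Fintype.card A * Real.exp H := mul_pos (by exact_mod_cast Fintype.card_pos) (Real.exp_pos _)
  set K := Fintype.card A * Real.exp H
  have key : ∀ b, (Real.log (softmax p b) - Real.log (softmax q b)) ^ 2 ≤
      8 * K * (1 - softmaxAffinity p q) := by
    intro b
    have h1 := sq_log_sub_log_le (one_div_pos.2 hK) (inv_card_mul_exp_le_softmax hp b)
      (inv_card_mul_exp_le_softmax hq b)
    have h2 : (Real.sqrt (softmax p b) - Real.sqrt (softmax q b)) ^ 2 ≤
        2 * (1 - softmaxAffinity p q) := by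
      rw [← sum_sq_sqrt_softmax_sub]
      exact Finset.single_le_sum
        (f := fun b => (Real.sqrt (softmax p b) - Real.sqrt (softmax q b)) ^ 2)
        (fun b _ => sq_nonneg _) (Finset.mem_univ b)
    rw [div_div_eq_mul_div, div_one] at h1
    nlinarith
  have h1 := key a
  have h2 := key a₀
  rw [log_softmax, log_softmax] at h1 h2
  rw [hp0, hq0] at h2
  -- `(x - y) ^ 2 ≤ 2 x ^ 2 + 2 y ^ 2` for the log-ratios at `a` and `a₀`
  nlinarith [sq_nonneg ((p a - Real.log (∑ b, Real.exp (p b)) - (q a - Real.log (∑ b, Real.exp (q b))))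
    + (0 - Real.log (∑ b, Real.exp (p b)) - (0 - Real.log (∑ b, Real.exp (q b)))))]

/-- The exponential moment behind the likelihood ratio bound: if actions are drawn from `softmax p`,
then `√(π_q / π_p) · exp (1 - affinity)` has expectation at most one. -/
theorem sum_softmax_mul_exp_half_log_le [Nonempty A] (p q : A → ℝ) :
    ∑ a, softmax p a * Real.exp ((Real.log (softmax q a) - Real.log (softmax p a)) / 2 +
      (1 - softmaxAffinity p q)) ≤ 1 := by
  have h : ∀ a, softmax p a * Real.exp ((Real.log (softmax q a) - Real.log (softmax p a)) / 2 +
      (1 - softmaxAffinity p q)) = Real.sqrt (softmax p a) * Real.sqrt (softmax q a) *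
        Real.exp (1 - softmaxAffinity p q) := by
    intro a
    have e : ∀ x : ℝ, 0 < x → Real.exp (Real.log x / 2) = Real.sqrt x := fun x hx => by
      rw [← Real.log_sqrt hx.le, Real.exp_log (Real.sqrt_pos.2 hx)]
    rw [Real.exp_add, sub_div, Real.exp_sub, e _ (softmax_pos q a), e _ (softmax_pos p a)]
    have h1 := (Real.sqrt_pos.2 (softmax_pos p a)).ne'
    field_simp
    rw [Real.sq_sqrt (softmax_pos p a).le, mul_comm]
  simp only [h]
  rw [← Finset.sum_mul]
  change softmaxAffinity p q * _ ≤ 1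
  have h1 := Real.add_one_le_exp (softmaxAffinity p q - 1)
  calc softmaxAffinity p q * Real.exp (1 - softmaxAffinity p q)
      ≤ Real.exp (softmaxAffinity p q - 1) * Real.exp (1 - softmaxAffinity p q) :=
        mul_le_mul_of_nonneg_right (by linarith) (Real.exp_pos _).le
    _ = 1 := by rw [← Real.exp_add]; simp

end Softmax

/-! ### Ridge regression -/

section Ridge

variable {d n : ℕ}

theorem dotProduct_ridge_mulVec (v : Fin n → EuclideanSpace ℝ (Fin d)) (lam : ℝ)
    (x u : EuclideanSpace ℝ (Fin d)) :
    x.ofLp ⬝ᵥ ((∑ i, Matrix.vecMulVec (v i).ofLp (v i).ofLp +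
      lam • (1 : Matrix (Fin d) (Fin d) ℝ)) *ᵥ u.ofLp) =
      ∑ i, inner ℝ (v i) x * inner ℝ (v i) u + lam * inner ℝ x u := by
  have hinner : ∀ y z : EuclideanSpace ℝ (Fin d), inner ℝ y z = y.ofLp ⬝ᵥ z.ofLp := by
    intro y z
    rw [EuclideanSpace.inner_eq_star_dotProduct, dotProduct_comm]
    simp
  simp only [hinner, Matrix.add_mulVec, Matrix.sum_mulVec, Matrix.smul_mulVec, Matrix.one_mulVec,
    dotProduct_add, dotProduct_sum, dotProduct_smul, smul_eq_mul, Matrix.vecMulVec_mulVec]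
  congr 1
  refine Finset.sum_congr rfl fun i _ => ?_
  rw [dotProduct_comm x.ofLp (v i).ofLp]
  simp

/-- The quadratic form `uᵀ (∑ i, v i (v i)ᵀ + lam I) u` of ridge regression. -/
noncomputable def ridgeEnergy (v : Fin n → EuclideanSpace ℝ (Fin d)) (lam : ℝ)
    (u : EuclideanSpace ℝ (Fin d)) : ℝ :=
  ∑ i, inner ℝ (v i) u ^ 2 + lam * ‖u‖ ^ 2

variable {v : Fin n → EuclideanSpace ℝ (Fin d)} {lam : ℝ}

theorem ridgeEnergy_nonneg (hlam : 0 < lam) (u : EuclideanSpace ℝ (Fin d)) :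
    0 ≤ ridgeEnergy v lam u :=
  add_nonneg (Finset.sum_nonneg fun _ _ => sq_nonneg _) (by positivity)

theorem sum_sq_inner_le_ridgeEnergy (hlam : 0 < lam) (u : EuclideanSpace ℝ (Fin d)) :
    ∑ i, inner ℝ (v i) u ^ 2 ≤ ridgeEnergy v lam u :=
  le_add_of_nonneg_right (by positivity)

theorem sqrt_mul_norm_le_sqrt_ridgeEnergy (hlam : 0 < lam) (u : EuclideanSpace ℝ (Fin d)) :
    Real.sqrt lam * ‖u‖ ≤ Real.sqrt (ridgeEnergy v lam u) := by
  rw [← Real.sqrt_sq (norm_nonneg u), ← Real.sqrt_mul hlam.le]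
  exact Real.sqrt_le_sqrt (le_add_of_nonneg_left (Finset.sum_nonneg fun _ _ => sq_nonneg _))

theorem abs_ridge_inner_le (hlam : 0 < lam) (x u : EuclideanSpace ℝ (Fin d)) :
    |∑ i, inner ℝ (v i) x * inner ℝ (v i) u + lam * inner ℝ x u| ≤
      Real.sqrt (ridgeEnergy v lam x) * Real.sqrt (ridgeEnergy v lam u) := by
  set b := ∑ i, inner ℝ (v i) x * inner ℝ (v i) u + lam * inner ℝ x u with hb
  have h : ∀ t : ℝ, 0 ≤ ridgeEnergy v lam x * (t * t) + 2 * b * t + ridgeEnergy v lam u := by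
    intro t
    have : ridgeEnergy v lam x * (t * t) + 2 * b * t + ridgeEnergy v lam u =
        ridgeEnergy v lam (t • x + u) := by
      simp only [ridgeEnergy, hb, inner_add_right, inner_smul_right, add_sq]
      rw [norm_add_sq_real, norm_smul, inner_smul_left]
      simp only [Finset.sum_add_distrib, mul_pow, Finset.mul_sum, Finset.sum_mul, mul_add, add_mul,
        Real.norm_eq_abs, sq_abs, RCLike.conj_to_real]
      have e1 : ∀ i, inner ℝ (v i) x ^ 2 * (t * t) = t ^ 2 * inner ℝ (v i) x ^ 2 := fun i => by ring
      have e2 : ∀ i, 2 * (inner ℝ (v i) x * inner ℝ (v i) u) * t =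
        2 * (t * inner ℝ (v i) x) * inner ℝ (v i) u := fun i => by ring
      simp only [e1, e2]
      ring
    rw [this]
    exact ridgeEnergy_nonneg hlam _
  have hd := discrim_le_zero h
  rw [← Real.sqrt_mul (ridgeEnergy_nonneg hlam x)]
  apply Real.abs_le_sqrt
  rw [discrim] at hd
  nlinarith

theorem abs_inner_le_matNorm_mul (hlam : 0 < lam) (x u : EuclideanSpace ℝ (Fin d)) :
    |inner ℝ x u| ≤ matNorm (∑ i, Matrix.vecMulVec (v i).ofLp (v i).ofLp +
      lam • (1 : Matrix (Fin d) (Fin d) ℝ))⁻¹ x * Real.sqrt (ridgeEnergy v lam u) := by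
  set B := ∑ i, Matrix.vecMulVec (v i).ofLp (v i).ofLp + lam • (1 : Matrix (Fin d) (Fin d) ℝ) with hB
  have hunit : IsUnit B := by
    rw [← Matrix.mulVec_injective_iff_isUnit]
    change Function.Injective (Matrix.mulVecLin B)
    rw [injective_iff_map_eq_zero]
    intro z hz
    have h1 := dotProduct_ridge_mulVec v lam (WithLp.toLp 2 z) (WithLp.toLp 2 z)
    rw [← hB] at h1
    simp only [Matrix.mulVecLin_apply] at hz
    simp only [hz, dotProduct_zero] at h1
    have h2 : 0 ≤ ∑ i, inner ℝ (v i) (WithLp.toLp 2 z) * inner ℝ (v i) (WithLp.toLp 2 z) :=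
      Finset.sum_nonneg fun _ _ => mul_self_nonneg _
    rw [real_inner_self_eq_norm_sq] at h1
    have h3 : ‖(WithLp.toLp 2 z : EuclideanSpace ℝ (Fin d))‖ ^ 2 = 0 := by
      have := sq_nonneg ‖(WithLp.toLp 2 z : EuclideanSpace ℝ (Fin d))‖
      nlinarith
    have h4 := norm_eq_zero.1 (pow_eq_zero_iff two_ne_zero |>.1 h3)
    simpa using congrArg WithLp.ofLp h4
  have hdet : IsUnit B.det := (Matrix.isUnit_iff_isUnit_det B).1 hunit
  set y : EuclideanSpace ℝ (Fin d) := WithLp.toLp 2 (B⁻¹ *ᵥ x.ofLp) with hy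
  have hBy : B *ᵥ y.ofLp = x.ofLp := by
    simp [hy, Matrix.mulVec_mulVec, Matrix.mul_nonsing_inv B hdet]
  have e1 : inner ℝ x u = ∑ i, inner ℝ (v i) y * inner ℝ (v i) u + lam * inner ℝ y u := by
    have := dotProduct_ridge_mulVec v lam u y
    rw [← hB, hBy] at this
    rw [EuclideanSpace.inner_eq_star_dotProduct]
    simp only [star_trivial]
    rw [this, real_inner_comm]
    congr 1
    exact Finset.sum_congr rfl fun i _ => mul_comm _ _
  have e2 : matNorm B⁻¹ x = Real.sqrt (ridgeEnergy v lam y) := by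
    have := dotProduct_ridge_mulVec v lam y y
    rw [← hB, hBy] at this
    rw [matNorm, ridgeEnergy, dotProduct_comm]
    change Real.sqrt (y.ofLp ⬝ᵥ x.ofLp) = _
    rw [this, real_inner_self_eq_norm_sq]
    simp only [sq]
  rw [e1, e2]
  exact abs_ridge_inner_le hlam y u

/-- First order condition for the ridge regression estimate. -/
theorem ridge_stationary (hlam : 0 < lam) {y : Fin n → ℝ} {w : EuclideanSpace ℝ (Fin d)}
    (hw : IsMinOn (fun u => ∑ i, (inner ℝ (v i) u - y i) ^ 2 + lam * ‖u‖ ^ 2) Set.univ w)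
    (u : EuclideanSpace ℝ (Fin d)) :
    ∑ i, (inner ℝ (v i) w - y i) * inner ℝ (v i) u + lam * inner ℝ w u = 0 := by
  set L := ∑ i, (inner ℝ (v i) w - y i) * inner ℝ (v i) u + lam * inner ℝ w u with hL
  have h : ∀ t : ℝ, 0 ≤ 2 * t * L + t ^ 2 * ridgeEnergy v lam u := by
    intro t
    have h1 := hw (Set.mem_univ (w + t • u))
    simp only [Set.mem_ofPred_eq] at h1
    have h2 : ∑ i, (inner ℝ (v i) (w + t • u) - y i) ^ 2 + lam * ‖w + t • u‖ ^ 2 =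
        ∑ i, (inner ℝ (v i) w - y i) ^ 2 + lam * ‖w‖ ^ 2 +
          (2 * t * L + t ^ 2 * ridgeEnergy v lam u) := by
      rw [norm_add_sq_real, norm_smul, inner_smul_right, mul_pow, Real.norm_eq_abs, sq_abs, hL,
        ridgeEnergy]
      have : ∀ i, (inner ℝ (v i) (w + t • u) - y i) ^ 2 = (inner ℝ (v i) w - y i) ^ 2 +
          2 * t * ((inner ℝ (v i) w - y i) * inner ℝ (v i) u) + t ^ 2 * inner ℝ (v i) u ^ 2 := by
        intro i
        rw [inner_add_right, inner_smul_right]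
        ring
      simp only [this, Finset.sum_add_distrib, ← Finset.mul_sum]
      ring
    linarith
  have hQ := ridgeEnergy_nonneg (v := v) hlam u
  set Q := ridgeEnergy v lam u
  have h1 := h (-L / (Q + 1))
  have h2 : 2 * (-L / (Q + 1)) * L + (-L / (Q + 1)) ^ 2 * Q = -(L ^ 2 * (Q + 2)) / (Q + 1) ^ 2 := by
    field_simp
    ring
  rw [h2, neg_div, Left.nonneg_neg_iff] at h1
  have h3 : L ^ 2 * (Q + 2) ≤ 0 := by
    by_contra hc
    exact absurd h1 (not_le.2 (div_pos (not_le.1 hc) (by positivity)))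
  have h4 : L ^ 2 = 0 := by nlinarith [sq_nonneg L]
  exact pow_eq_zero_iff two_ne_zero |>.1 h4

/-- Error of the ridge regression estimate `w'` of `w` when the responses are `⟪v i, w⟫ + ε i` and
the residual functional `u ↦ ∑ i, ε i ⟪v i, u⟫` has norm at most `B` for the ridge energy. -/
theorem abs_inner_sub_le_of_isMinOn (hlam : 0 < lam) {ε : Fin n → ℝ} {B : ℝ} (hB0 : 0 ≤ B)
    {w w' : EuclideanSpace ℝ (Fin d)}
    (hw : IsMinOn (fun u => ∑ i, (inner ℝ (v i) u - (inner ℝ (v i) w + ε i)) ^ 2 +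
      lam * ‖u‖ ^ 2) Set.univ w')
    (hB : ∀ u, ∑ i, ε i * inner ℝ (v i) u ≤ B * Real.sqrt (ridgeEnergy v lam u))
    (x : EuclideanSpace ℝ (Fin d)) :
    |inner ℝ x w - inner ℝ x w'| ≤ matNorm (∑ i, Matrix.vecMulVec (v i).ofLp (v i).ofLp +
      lam • (1 : Matrix (Fin d) (Fin d) ℝ))⁻¹ x * (B + Real.sqrt lam * ‖w‖) := by
  set D := w' - w with hD
  have h1 := ridge_stationary hlam hw D
  have h2 : ridgeEnergy v lam D = ∑ i, ε i * inner ℝ (v i) D - lam * inner ℝ w D := by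
    have e : ridgeEnergy v lam D = ∑ i, ε i * inner ℝ (v i) D +
        (∑ i, (inner ℝ (v i) w' - (inner ℝ (v i) w + ε i)) * inner ℝ (v i) D +
        lam * inner ℝ w' D) - lam * inner ℝ w D := by
      have e1 : ∀ i, inner ℝ (v i) D ^ 2 = ε i * inner ℝ (v i) D +
          (inner ℝ (v i) w' - (inner ℝ (v i) w + ε i)) * inner ℝ (v i) D := by
        intro i
        have : inner ℝ (v i) D = inner ℝ (v i) w' - inner ℝ (v i) w := by rw [hD, inner_sub_right]
        rw [this]; ring
      have e2 : ‖D‖ ^ 2 = inner ℝ w' D - inner ℝ w D := by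
        rw [← inner_sub_left, ← hD, real_inner_self_eq_norm_sq]
      rw [ridgeEnergy, Finset.sum_congr rfl fun i _ => e1 i, e2, Finset.sum_add_distrib]
      ring
    rw [e, h1, add_zero]
  have h0 := ridgeEnergy_nonneg (v := v) hlam D
  have h3 : Real.sqrt (ridgeEnergy v lam D) ≤ B + Real.sqrt lam * ‖w‖ := by
    have h4 : -(lam * inner ℝ w D) ≤ Real.sqrt lam * ‖w‖ * Real.sqrt (ridgeEnergy v lam D) := by
      have a1 := (abs_le.1 (abs_real_inner_le_norm w D)).1
      have a2 := sqrt_mul_norm_le_sqrt_ridgeEnergy (v := v) hlam D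
      have a3 := Real.mul_self_sqrt hlam.le
      have a4 : 0 ≤ Real.sqrt lam * ‖w‖ := by positivity
      calc -(lam * inner ℝ w D) ≤ lam * (‖w‖ * ‖D‖) := by nlinarith
        _ = Real.sqrt lam * ‖w‖ * (Real.sqrt lam * ‖D‖) := by linear_combination -(‖w‖ * ‖D‖) * a3
        _ ≤ _ := mul_le_mul_of_nonneg_left a2 a4
    have h5 : Real.sqrt (ridgeEnergy v lam D) * Real.sqrt (ridgeEnergy v lam D) ≤
        (B + Real.sqrt lam * ‖w‖) * Real.sqrt (ridgeEnergy v lam D) := by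
      rw [Real.mul_self_sqrt h0]
      linarith [hB D]
    rcases (Real.sqrt_nonneg (ridgeEnergy v lam D)).eq_or_lt with h6 | h6
    · rw [← h6]
      positivity
    · exact le_of_mul_le_mul_right h5 h6
  rw [abs_sub_comm, ← inner_sub_right, ← hD]
  exact (abs_inner_le_matNorm_mul hlam x D).trans
    (mul_le_mul_of_nonneg_left h3 (Real.sqrt_nonneg _))

end Ridge

/-! ### Products of kernels -/

section PiKernel

variable {ι X Y : Type*} [Fintype ι] [MeasurableSpace X] [MeasurableSpace Y]

/-- The kernel drawing the coordinates `y i` independently from `κ (x i)`. -/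
noncomputable def piKernel (ι : Type*) [Fintype ι] (κ : Kernel X Y) [IsMarkovKernel κ] :
    Kernel (ι → X) (ι → Y) where
  toFun x := Measure.pi fun i => κ (x i)
  measurable' := by
    refine Measurable.measure_of_isPiSystem_of_isProbabilityMeasure generateFrom_pi.symm
      isPiSystem_pi ?_
    rintro _ ⟨t, ht, rfl⟩
    simp only [Measure.pi_pi]
    exact Finset.measurable_prod _ fun i _ =>
      (κ.measurable_coe (ht i (Set.mem_univ i))).comp (measurable_pi_apply i)

theorem piKernel_apply (κ : Kernel X Y) [IsMarkovKernel κ] (x : ι → X) :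
    piKernel ι κ x = Measure.pi fun i => κ (x i) := rfl

instance isMarkovKernel_piKernel (κ : Kernel X Y) [IsMarkovKernel κ] :
    IsMarkovKernel (piKernel ι κ) :=
  ⟨fun x => by rw [piKernel_apply]; infer_instance⟩

theorem lintegral_pi_prod (ν : ι → Measure X) [∀ i, IsProbabilityMeasure (ν i)]
    {f : ι → X → ℝ≥0∞} (hf : ∀ i, Measurable (f i)) :
    ∫⁻ x, ∏ i, f i (x i) ∂(Measure.pi ν) = ∏ i, ∫⁻ x, f i x ∂(ν i) := by
  rw [lintegral_prod_eq_prod_lintegral_of_indepFun Finset.univ (fun i (x : ι → X) => f i (x i))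
    (iIndepFun_pi fun i => (hf i).aemeasurable) fun i => (hf i).comp (measurable_pi_apply i)]
  exact Finset.prod_congr rfl fun i _ => (measurePreserving_eval ν i).lintegral_comp (hf i)

/-- Independent pairs can be sampled by drawing all first coordinates, then all second coordinates
given the first ones. -/
theorem pi_compProd_eq_map (ν : ι → Measure X) [∀ i, IsProbabilityMeasure (ν i)] (κ : Kernel X Y)
    [IsMarkovKernel κ] :
    Measure.pi (fun i => ν i ⊗ₘ κ) = (Measure.pi ν ⊗ₘ piKernel ι κ).map
      (MeasurableEquiv.arrowProdEquivProdArrow X Y ι).symm := by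
  have hspan : ∀ i, (ν i ⊗ₘ κ).FiniteSpanningSetsIn
      (Set.image2 (· ×ˢ ·) {s : Set X | MeasurableSet s} {t : Set Y | MeasurableSet t}) := fun i =>
    { set := fun _ => Set.univ
      set_mem := fun _ => ⟨Set.univ, MeasurableSet.univ, Set.univ, MeasurableSet.univ,
        Set.univ_prod_univ⟩
      finite := fun _ => measure_lt_top _ _
      spanning := Set.iUnion_const _ }
  refine Measure.pi_eq_generateFrom (fun _ => generateFrom_prod) (fun _ => isPiSystem_prod) hspan ?_
  intro s hs
  choose p hp q hq hpq using hs
  have hpre : (MeasurableEquiv.arrowProdEquivProdArrow X Y ι).symm ⁻¹' (Set.univ.pi s) =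
      Set.univ.pi p ×ˢ Set.univ.pi q := by
    ext z
    simp only [Set.mem_preimage, Set.mem_pi, Set.mem_univ, true_implies, Set.mem_prod, ← hpq]
    exact forall_and
  have hp' : ∀ i, MeasurableSet (p i) := hp
  have hq' : ∀ i, MeasurableSet (q i) := hq
  rw [MeasurableEquiv.map_apply, hpre, Measure.compProd_apply_prod (MeasurableSet.univ_pi hp')
    (MeasurableSet.univ_pi hq'), ← lintegral_indicator (MeasurableSet.univ_pi hp')]
  have hind : ∀ x : ι → X, (Set.univ.pi p).indicator
      (fun a => piKernel ι κ a (Set.univ.pi q)) x =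
        ∏ i, (p i).indicator (fun a => κ a (q i)) (x i) := by
    intro x
    by_cases hx : x ∈ Set.univ.pi p
    · rw [Set.indicator_of_mem hx, piKernel_apply, Measure.pi_pi]
      exact Finset.prod_congr rfl fun i _ => by rw [Set.indicator_of_mem (hx i (Set.mem_univ i))]
    · rw [Set.indicator_of_notMem hx]
      obtain ⟨i, hi⟩ : ∃ i, x i ∉ p i := by simpa [Set.mem_pi] using hx
      exact (Finset.prod_eq_zero (Finset.mem_univ i) (Set.indicator_of_notMem hi _)).symm
  simp only [hind]
  rw [lintegral_pi_prod ν fun i => (κ.measurable_coe (hq' i)).indicator (hp' i)]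
  refine Finset.prod_congr rfl fun i _ => ?_
  rw [lintegral_indicator (hp' i), ← hpq, Measure.compProd_apply_prod (hp' i) (hq' i)]

theorem pi_compProd_le (ν : ι → Measure X) [∀ i, IsProbabilityMeasure (ν i)] (κ : Kernel X Y)
    [IsMarkovKernel κ] {B : Set (ι → X × Y)} (hB : MeasurableSet B) {b : ℝ≥0∞}
    (h : ∀ x : ι → X, Measure.pi (fun i => κ (x i)) {y | (fun i => (x i, y i)) ∈ B} ≤ b) :
    Measure.pi (fun i => ν i ⊗ₘ κ) B ≤ b := by
  rw [pi_compProd_eq_map, MeasurableEquiv.map_apply,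
    Measure.compProd_apply ((MeasurableEquiv.measurable _) hB)]
  calc _ ≤ ∫⁻ _, b ∂(Measure.pi ν) := lintegral_mono fun x => h x
    _ = b := by simp

end PiKernel

/-! ### Projection of bounded independent noise -/

section Noise

/-- If all coordinates of `η` along an orthonormal basis of `R` are at most `t`, so is, up to the
factor `√d`, its component in `R`. -/
theorem inner_le_of_abs_inner_basis_le {F : Type*} [NormedAddCommGroup F] [InnerProductSpace ℝ F]
    {ι : Type*} [Fintype ι] {R : Submodule ℝ F} (b : OrthonormalBasis ι ℝ R) {d : ℕ}
    (hd : Fintype.card ι ≤ d) {η : F} {t : ℝ} (ht : 0 ≤ t)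
    (h : ∀ j, |inner ℝ (b j : F) η| ≤ t) (r : R) :
    inner ℝ η (r : F) ≤ Real.sqrt d * t * ‖(r : F)‖ := by
  have h1 : (r : F) = ∑ j, inner ℝ (b j) r • (b j : F) := by
    conv_lhs => rw [← b.sum_repr' r]
    push_cast
    rfl
  have h2 : inner ℝ η (r : F) = ∑ j, inner ℝ (b j : F) η * inner ℝ (b j) r := by
    conv_lhs => rw [h1]
    rw [inner_sum]
    refine Finset.sum_congr rfl fun j _ => ?_
    rw [inner_smul_right, mul_comm, real_inner_comm (b j : F) η]
  rw [h2]
  refine (Real.sum_mul_le_sqrt_mul_sqrt _ _ _).trans ?_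
  have h3 : ∑ j, inner ℝ (b j) r ^ 2 = ‖(r : F)‖ ^ 2 := by
    have := b.sum_sq_norm_inner_right r
    simpa only [Real.norm_eq_abs, sq_abs, Submodule.coe_norm] using this
  rw [h3, Real.sqrt_sq (norm_nonneg _)]
  refine mul_le_mul_of_nonneg_right ?_ (norm_nonneg _)
  rw [← Real.sqrt_sq ht, ← Real.sqrt_mul (Nat.cast_nonneg d)]
  refine Real.sqrt_le_sqrt ?_
  calc ∑ j, inner ℝ (b j : F) η ^ 2 ≤ ∑ _j : ι, t ^ 2 :=
        Finset.sum_le_sum fun j _ => sq_le_sq.2 ((h j).trans (le_abs_self t))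
    _ = Fintype.card ι * t ^ 2 := by simp
    _ ≤ d * t ^ 2 := by gcongr

variable {Y : Type*} [MeasurableSpace Y] {n d : ℕ}

/-- Hoeffding's inequality for a fixed unit combination of centered bounded variables. -/
theorem measure_abs_sum_mul_gt_le (ρ : Fin n → Measure Y) [∀ i, IsProbabilityMeasure (ρ i)]
    {V : Y → ℝ} (hV : Measurable V) {H : ℝ} (hH : 0 < H) (hVH : ∀ y, V y ∈ Set.Icc 0 H)
    {e : Fin n → ℝ} (he : ∑ i, e i ^ 2 = 1) {p : ℝ} (hp : 0 < p) (hp2 : p ≤ 2) :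
    (Measure.pi ρ) {y | H * Real.sqrt (Real.log (2 / p)) <
      |∑ i, e i * (V (y i) - ∫ z, V z ∂(ρ i))|} ≤ ENNReal.ofReal p := by
  set t := H * Real.sqrt (Real.log (2 / p)) with ht
  have hlog : 0 ≤ Real.log (2 / p) := Real.log_nonneg (by rw [le_div_iff₀ hp]; linarith)
  have ht0 : 0 ≤ t := by positivity
  have hs : ∀ σ : ℝ, σ ^ 2 = 1 → (Measure.pi ρ).real {y | t ≤
      ∑ i, (σ * e i) * (V (y i) - ∫ z, V z ∂(ρ i))} ≤ p / 2 := by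
    intro σ hσ
    have h1 : ∀ i, HasSubgaussianMGF (fun y : Fin n → Y => (σ * e i) * (V (y i) - ∫ z, V z ∂(ρ i)))
        (Real.toNNReal ((σ * e i) ^ 2 * (H ^ 2 / 4))) (Measure.pi ρ) := by
      intro i
      have h2 : HasSubgaussianMGF (fun z => V z - ∫ z, V z ∂(ρ i)) ((‖H - 0‖₊ / 2) ^ 2)
          ((Measure.pi ρ).map fun y => y i) := by
        rw [show (Measure.pi ρ).map (fun y => y i) = ρ i from (measurePreserving_eval ρ i).map_eq]
        exact hasSubgaussianMGF_of_mem_Icc hV.aemeasurable (Filter.Eventually.of_forall hVH)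
      have hev : AEMeasurable (fun y : Fin n → Y => y i) (Measure.pi ρ) :=
        (measurable_pi_apply i).aemeasurable
      convert (h2.of_map hev).const_mul (σ * e i) using 1
      · rfl
      refine NNReal.eq ?_
      rw [Real.coe_toNNReal _ (by positivity)]
      change _ = (σ * e i) ^ 2 * (‖H - 0‖ / 2) ^ 2
      rw [sub_zero, Real.norm_eq_abs, abs_of_pos hH]
      norm_num [div_pow]
    have hind : iIndepFun (fun i (y : Fin n → Y) => (σ * e i) * (V (y i) - ∫ z, V z ∂(ρ i)))
        (Measure.pi ρ) :=
      iIndepFun_pi (X := fun i z => (σ * e i) * (V z - ∫ z, V z ∂(ρ i)))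
        fun i => ((hV.sub_const _).const_mul _).aemeasurable
    have h3 := (HasSubgaussianMGF.sum_of_iIndepFun hind (s := Finset.univ)
      fun i _ => h1 i).measure_ge_le ht0
    refine h3.trans ?_
    have h4 : ((∑ i, Real.toNNReal ((σ * e i) ^ 2 * (H ^ 2 / 4)) : ℝ≥0) : ℝ) = H ^ 2 / 4 := by
      rw [NNReal.coe_sum, Finset.sum_congr rfl fun i _ => Real.coe_toNNReal _ (by positivity),
        ← Finset.sum_mul]
      simp only [mul_pow, hσ, one_mul, he]
    rw [h4, ht, mul_pow, Real.sq_sqrt hlog]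
    have h5 : -(H ^ 2 * Real.log (2 / p)) / (2 * (H ^ 2 / 4)) = -(2 * Real.log (2 / p)) := by
      field_simp
      ring
    rw [h5]
    calc Real.exp (-(2 * Real.log (2 / p))) ≤ Real.exp (-Real.log (2 / p)) :=
          Real.exp_le_exp.2 (by linarith)
      _ = p / 2 := by rw [Real.exp_neg, Real.exp_log (by positivity), inv_div]
  have hsub : {y | t < |∑ i, e i * (V (y i) - ∫ z, V z ∂(ρ i))|} ⊆
      {y : Fin n → Y | t ≤ ∑ i, (1 * e i) * (V (y i) - ∫ z, V z ∂(ρ i))} ∪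
      {y | t ≤ ∑ i, (-1 * e i) * (V (y i) - ∫ z, V z ∂(ρ i))} := by
    intro y hy
    rcases lt_abs.1 (show t < |_| from hy) with h | h
    · left
      simpa using h.le
    · right
      simpa [← Finset.sum_neg_distrib] using h.le
  have h1 := hs 1 (by norm_num)
  have h2 := hs (-1) (by norm_num)
  refine (measure_mono hsub).trans ?_
  rw [← ofReal_measureReal]
  refine ENNReal.ofReal_le_ofReal ?_
  linarith [measureReal_union_le (μ := Measure.pi ρ)
    {y : Fin n → Y | t ≤ ∑ i, (1 * e i) * (V (y i) - ∫ z, V z ∂(ρ i))}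
    {y | t ≤ ∑ i, (-1 * e i) * (V (y i) - ∫ z, V z ∂(ρ i))}]

/-- For fixed design vectors `v i`, the component of the noise in the at most `d`-dimensional range
of the design is of order `H √d`, uniformly over all directions `u`. -/
theorem measure_exists_noise_gt_le (hd : 0 < d) (ρ : Fin n → Measure Y)
    [∀ i, IsProbabilityMeasure (ρ i)] {V : Y → ℝ} (hV : Measurable V) {H : ℝ} (hH : 0 < H)
    (hVH : ∀ y, V y ∈ Set.Icc 0 H) (v : Fin n → EuclideanSpace ℝ (Fin d)) {p : ℝ} (hp : 0 < p)
    (hp1 : p ≤ 1) :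
    (Measure.pi ρ) {y | ∃ u, Real.sqrt d * (H * Real.sqrt (Real.log (2 * d / p))) *
      Real.sqrt (∑ i, inner ℝ (v i) u ^ 2) <
        ∑ i, (V (y i) - ∫ z, V z ∂(ρ i)) * inner ℝ (v i) u} ≤ ENNReal.ofReal p := by
  have hd1 : (1 : ℝ) ≤ d := by exact_mod_cast hd
  let Φ : EuclideanSpace ℝ (Fin d) →ₗ[ℝ] EuclideanSpace ℝ (Fin n) :=
    { toFun := fun u => WithLp.toLp 2 fun i => inner ℝ (v i) u
      map_add' := fun x y => by ext i; simp [inner_add_right]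
      map_smul' := fun c x => by ext i; simp [inner_smul_right] }
  set R := LinearMap.range Φ
  let b := stdOrthonormalBasis ℝ R
  have hcard : Fintype.card (Fin (Module.finrank ℝ R)) ≤ d := by
    have := LinearMap.finrank_range_le Φ
    simpa using this
  have hpd : 2 * (d : ℝ) / p = 2 / (p / d) := by field_simp
  rw [hpd]
  set t := H * Real.sqrt (Real.log (2 / (p / d)))
  have ht0 : 0 ≤ t := by positivity
  have hinner : ∀ x y : EuclideanSpace ℝ (Fin n), inner ℝ x y = ∑ i, x i * y i := by
    intro x y
    rw [PiLp.inner_apply]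
    exact Finset.sum_congr rfl fun i _ => by simp [mul_comm]
  have hsub : {y | ∃ u, Real.sqrt d * t * Real.sqrt (∑ i, inner ℝ (v i) u ^ 2) <
        ∑ i, (V (y i) - ∫ z, V z ∂(ρ i)) * inner ℝ (v i) u} ⊆
      ⋃ j, {y : Fin n → Y | t < |∑ i, (b j : EuclideanSpace ℝ (Fin n)) i *
        (V (y i) - ∫ z, V z ∂(ρ i))|} := by
    rintro y ⟨u, hu⟩
    by_contra hc
    simp only [Set.mem_iUnion, Set.mem_ofPred_eq, not_exists, not_lt] at hc
    have h1 := inner_le_of_abs_inner_basis_le b hcard (t := t)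
      (η := WithLp.toLp 2 fun i => V (y i) - ∫ z, V z ∂(ρ i)) ht0
      (fun j => by rw [hinner]; exact hc j) ⟨Φ u, LinearMap.mem_range_self Φ u⟩
    rw [hinner, EuclideanSpace.norm_eq] at h1
    simp only [Real.norm_eq_abs, sq_abs] at h1
    exact absurd h1 (not_le.2 hu)
  refine (measure_mono hsub).trans ((measure_iUnion_fintype_le _ _).trans ?_)
  calc _ ≤ ∑ _j : Fin (Module.finrank ℝ R), ENNReal.ofReal (p / d) := by
        refine Finset.sum_le_sum fun j _ => ?_
        refine measure_abs_sum_mul_gt_le ρ hV hH hVH ?_ (by positivity) ?_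
        · have h1 : ‖(b j : EuclideanSpace ℝ (Fin n))‖ = 1 := b.orthonormal.1 j
          have h2 := EuclideanSpace.norm_sq_eq (b j : EuclideanSpace ℝ (Fin n))
          rw [h1] at h2
          simpa using h2.symm
        · exact (div_le_self hp.le hd1).trans (by linarith)
    _ = (Fintype.card (Fin (Module.finrank ℝ R)) : ℝ≥0∞) * ENNReal.ofReal (p / d) := by simp
    _ ≤ (d : ℝ≥0∞) * ENNReal.ofReal (p / d) := by gcongr
    _ = ENNReal.ofReal p := by
        rw [← ENNReal.ofReal_natCast, ← ENNReal.ofReal_mul (Nat.cast_nonneg d)]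
        congr 1
        field_simp

/-- The event that the centered values `V (y i) - ∫ V dκ(x i)` correlate too strongly with some
linear function of the design vectors `v (x i)`. -/
def noiseEvent {X : Type*} [MeasurableSpace X] (κ : Kernel X Y) (V : Y → ℝ)
    (v : X → EuclideanSpace ℝ (Fin d)) (n : ℕ) (W : ℝ) : Set (Fin n → X × Y) :=
  {z | ∃ u, W * Real.sqrt (∑ i, inner ℝ (v (z i).1) u ^ 2) <
    ∑ i, (V (z i).2 - ∫ y, V y ∂(κ (z i).1)) * inner ℝ (v (z i).1) u}

variable {X : Type*} [MeasurableSpace X]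

theorem measurableSet_noiseEvent {κ : Kernel X Y} {V : Y → ℝ} (hV : Measurable V)
    {v : X → EuclideanSpace ℝ (Fin d)} (hv : Measurable v) (W : ℝ) :
    MeasurableSet (noiseEvent κ V v n W) := by
  -- by continuity in `u`, a countable dense set of directions suffices
  have h : noiseEvent κ V v n W = ⋃ k : ℕ,
      {z | W * Real.sqrt (∑ i, inner ℝ (v (z i).1) (TopologicalSpace.denseSeq _ k) ^ 2) <
        ∑ i, (V (z i).2 - ∫ y, V y ∂(κ (z i).1)) *
          inner ℝ (v (z i).1) (TopologicalSpace.denseSeq _ k)} := by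
    ext z
    simp only [noiseEvent, Set.mem_ofPred_eq, Set.mem_iUnion]
    refine ⟨fun ⟨u, hu⟩ => ?_, fun ⟨k, hk⟩ => ⟨_, hk⟩⟩
    have hopen : IsOpen {u : EuclideanSpace ℝ (Fin d) |
        W * Real.sqrt (∑ i, inner ℝ (v (z i).1) u ^ 2) <
          ∑ i, (V (z i).2 - ∫ y, V y ∂(κ (z i).1)) * inner ℝ (v (z i).1) u} :=
      isOpen_lt (by fun_prop) (by fun_prop)
    obtain ⟨_, hw, k, rfl⟩ :=
      (TopologicalSpace.denseRange_denseSeq _).exists_mem_open hopen ⟨u, hu⟩ |>.imp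
        fun k hk => (⟨hk, k, rfl⟩ : _ ∧ ∃ k', _)
    exact ⟨_, hw⟩
  rw [h]
  have hm : Measurable fun x => ∫ y, V y ∂(κ x) :=
    (hV.stronglyMeasurable.integral_kernel).measurable
  have h1 : ∀ i : Fin n, Measurable fun z : Fin n → X × Y => (z i).1 := fun i =>
    measurable_fst.comp (measurable_pi_apply i)
  have h2 : ∀ i : Fin n, Measurable fun z : Fin n → X × Y => (z i).2 := fun i =>
    measurable_snd.comp (measurable_pi_apply i)
  have h3 : ∀ (i : Fin n) (u : EuclideanSpace ℝ (Fin d)),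
      Measurable fun z : Fin n → X × Y => inner ℝ (v (z i).1) u := fun i u =>
    (hv.comp (h1 i)).inner_const
  refine MeasurableSet.iUnion fun k => measurableSet_lt ?_ ?_
  · exact ((Finset.measurable_sum _ fun i _ => (h3 i _).pow_const 2).sqrt).const_mul W
  · exact Finset.measurable_sum _ fun i _ =>
      ((hV.comp (h2 i)).sub (hm.comp (h1 i))).mul (h3 i _)

/-- Uniform noise bound for independent pairs `Z i` whose second coordinate is drawn from `κ` given
the first: the design is random, but conditionally on it the noise is independent. -/
theorem measure_noiseEvent_le {Ω : Type*} [MeasurableSpace Ω] {μ : Measure Ω}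
    [IsProbabilityMeasure μ] (hd : 0 < d) {κ : Kernel X Y} [IsMarkovKernel κ] {V : Y → ℝ}
    (hV : Measurable V) {H : ℝ} (hH : 0 < H) (hVH : ∀ y, V y ∈ Set.Icc 0 H)
    {v : X → EuclideanSpace ℝ (Fin d)} (hv : Measurable v) {Z : Fin n → Ω → X × Y}
    (hZ : ∀ i, Measurable (Z i)) (hindep : iIndepFun Z μ)
    (hlaw : ∀ i, μ.map (Z i) = μ.map (fun ω => (Z i ω).1) ⊗ₘ κ) {p : ℝ} (hp : 0 < p)
    (hp1 : p ≤ 1) :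
    μ {ω | (fun i => Z i ω) ∈ noiseEvent κ V v n
      (Real.sqrt d * (H * Real.sqrt (Real.log (2 * d / p))))} ≤ ENNReal.ofReal p := by
  set B := noiseEvent κ V v n (Real.sqrt d * (H * Real.sqrt (Real.log (2 * d / p))))
  have hB : MeasurableSet B := measurableSet_noiseEvent hV hv _
  have h1 : μ {ω | (fun i => Z i ω) ∈ B} = μ.map (fun ω i => Z i ω) B :=
    (Measure.map_apply (measurable_pi_lambda _ hZ) hB).symm
  have : ∀ i, IsProbabilityMeasure (μ.map fun ω => (Z i ω).1) := fun i =>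
    Measure.isProbabilityMeasure_map (measurable_fst.comp (hZ i)).aemeasurable
  rw [h1, (iIndepFun_iff_map_fun_eq_pi_map fun i => (hZ i).aemeasurable).1 hindep]
  simp only [hlaw]
  exact pi_compProd_le _ κ hB fun x =>
    measure_exists_noise_gt_le hd (fun i => κ (x i)) hV hH hVH (fun i => v (x i)) hp hp1

end Noise

/-! ### The law of the trajectories -/

theorem measurable_softmax {S A : Type*} [MeasurableSpace S] [Fintype A] {q : S → A → ℝ}
    (hq : ∀ x, Measurable fun y => q y x) (x : A) :
    Measurable fun y => softmax (q y) x :=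
  (hq x).exp.div (Finset.measurable_sum _ fun b _ => (hq b).exp)

/-- The log-likelihood ratio of one observed choice, plus the squared Hellinger distance of the
choice probabilities, for the true action values `p` and the alternative `q`. -/
noncomputable def hellingerLogRatio {A : Type*} [Fintype A] (p q : A → ℝ) (x : A) : ℝ :=
  (Real.log (softmax q x) - Real.log (softmax p x)) / 2 + (1 - softmaxAffinity p q)

theorem measurable_hellingerLogRatio {S A : Type*} [MeasurableSpace S] [Fintype A]
    {p q : S → A → ℝ} (hp : ∀ x, Measurable fun y => p y x)
    (hq : ∀ x, Measurable fun y => q y x) (x : A) :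
    Measurable fun y => hellingerLogRatio (p y) (q y) x := by
  refine (((measurable_softmax hq x).log.sub (measurable_softmax hp x).log).div_const 2).add
    (measurable_const.sub ?_)
  exact Finset.measurable_sum _ fun b _ =>
    (measurable_softmax hp b).sqrt.mul (measurable_softmax hq b).sqrt

section Trajectory

variable {Ω S A : Type*} [MeasurableSpace Ω] [MeasurableSpace S] [MeasurableSpace A] [Fintype A]
  {M : MDP S A} {γ : ℝ} {μ : Measure Ω}

theorem measurable_uncurry_of_discrete [DiscreteMeasurableSpace A] {β : Type*} [MeasurableSpace β]
    {f : S → A → β} (hf : ∀ x, Measurable fun y => f y x) :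
    Measurable fun z : S × A => f z.1 z.2 :=
  measurable_from_prod_countable_left hf

section Single

variable {s : ℕ → Ω → S} {a : ℕ → Ω → A}

theorem IsBehaviorTrajectory.lintegral_action [DiscreteMeasurableSpace A]
    (tr : IsBehaviorTrajectory M γ μ s a) {h : ℕ} (hh : h < M.horizon)
    (hπ : ∀ x, Measurable fun y => M.behaviorPolicy γ h y x) {f : S → A → ℝ≥0∞}
    (hf : ∀ x, Measurable fun y => f y x) :
    ∫⁻ ω, f (s h ω) (a h ω) ∂μ =
      ∫⁻ ω, ∑ x, f (s h ω) x * ENNReal.ofReal (M.behaviorPolicy γ h (s h ω) x) ∂μ := by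
  have hs := tr.measurable_state h hh
  have ha := tr.measurable_action h hh
  have hfs : ∀ x, Measurable fun ω => f (s h ω) x := fun x => (hf x).comp hs
  have hset : ∀ x, MeasurableSet {ω | a h ω = x} := fun x => ha (MeasurableSet.of_discrete (s := {x}))
  have hw : ∀ x, Measurable fun ω => ENNReal.ofReal (M.behaviorPolicy γ h (s h ω) x) := fun x =>
    ENNReal.measurable_ofReal.comp ((hπ x).comp hs)
  have hmap : ∀ x, (μ.restrict {ω | a h ω = x}).map (s h) =
      (μ.withDensity fun ω => ENNReal.ofReal (M.behaviorPolicy γ h (s h ω) x)).map (s h) := by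
    intro x
    ext D hD
    rw [Measure.map_apply hs hD, Measure.map_apply hs hD, Measure.restrict_apply (hs hD),
      withDensity_apply _ (hs hD)]
    exact tr.action h hh x (Prod.snd ⁻¹' D) (measurable_snd hD)
  have h1 : ∀ ω, f (s h ω) (a h ω) =
      ∑ x, {ω | a h ω = x}.indicator (fun ω => f (s h ω) x) ω := by
    intro ω
    rw [Finset.sum_eq_single (a h ω)]
    · rw [Set.indicator_of_mem (by rfl)]
    · intro x _ hx
      rw [Set.indicator_of_notMem]
      exact fun hc => hx hc.symm
    · simp
  simp only [h1]
  rw [lintegral_finsetSum _ fun x _ => (hfs x).indicator (hset x),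
    lintegral_finsetSum (f := fun x ω => f (s h ω) x *
      ENNReal.ofReal (M.behaviorPolicy γ h (s h ω) x)) _ fun x _ => (hfs x).mul (hw x)]
  refine Finset.sum_congr rfl fun x _ => ?_
  rw [lintegral_indicator (hset x), ← lintegral_map (hf x) hs, hmap x, lintegral_map (hf x) hs,
    lintegral_withDensity_eq_lintegral_mul _ (hw x) (hfs x)]
  exact lintegral_congr fun ω => mul_comm _ _

theorem IsBehaviorTrajectory.map_transition [IsProbabilityMeasure μ]
    (tr : IsBehaviorTrajectory M γ μ s a) {h : ℕ} (hh : h + 1 < M.horizon) :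
    haveI := M.isMarkov h
    μ.map (fun ω => ((s h ω, a h ω), s (h + 1) ω)) =
      μ.map (fun ω => (s h ω, a h ω)) ⊗ₘ M.trans h := by
  have := M.isMarkov h
  have hsa : Measurable fun ω => (s h ω, a h ω) :=
    (tr.measurable_state h (by omega)).prodMk (tr.measurable_action h (by omega))
  have hs' := tr.measurable_state (h + 1) hh
  have : IsProbabilityMeasure (μ.map fun ω => ((s h ω, a h ω), s (h + 1) ω)) :=
    Measure.isProbabilityMeasure_map (hsa.prodMk hs').aemeasurable
  refine Measure.ext_prod fun {D C} hD hC => ?_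
  rw [Measure.map_apply (hsa.prodMk hs') (hD.prod hC), Measure.compProd_apply_prod hD hC,
    setLIntegral_map hD ((M.trans h).measurable_coe hC) hsa]
  exact tr.trans h hh {z | z (Fin.last h) ∈ D} (measurable_pi_apply (Fin.last h) hD) C hC

end Single

variable [IsProbabilityMeasure μ] {n : ℕ} {s : Fin n → ℕ → Ω → S} {a : Fin n → ℕ → Ω → A}

/-- Chernoff bound for the sum over the trajectories of a function `g` of the state and the action
with conditional exponential moment at most one. -/
theorem measure_log_le_sum_le [DiscreteMeasurableSpace A]
    (tr : ∀ i, IsBehaviorTrajectory M γ μ (s i) (a i))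
    (hindep : iIndepFun (fun i ω => past (s i) (a i) M.horizon ω) μ) {h : ℕ} (hh : h < M.horizon)
    (hQ : ∀ x, Measurable fun y => M.agentQ γ h y x) {g : S → A → ℝ}
    (hgm : ∀ x, Measurable fun y => g y x)
    (hg : ∀ y, ∑ x, softmax (M.agentQ γ h y) x * Real.exp (g y x) ≤ 1) {p : ℝ} (hp : 0 < p) :
    μ {ω | Real.log (1 / p) ≤ ∑ i, g (s i h ω) (a i h ω)} ≤ ENNReal.ofReal p := by
  obtain ⟨F, hF⟩ : ∃ F : S → A → ℝ≥0∞, ∀ y x, F y x = ENNReal.ofReal (Real.exp (g y x)) :=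
    ⟨_, fun _ _ => rfl⟩
  have hFm : ∀ x, Measurable fun y => F y x := fun x => by
    simp only [hF]
    exact ENNReal.measurable_ofReal.comp (hgm x).exp
  have hF1 : ∀ i, ∫⁻ ω, F (s i h ω) (a i h ω) ∂μ ≤ 1 := by
    intro i
    rw [(tr i).lintegral_action hh (fun x => measurable_softmax hQ x) hFm]
    calc _ ≤ ∫⁻ _, 1 ∂μ := by
          refine lintegral_mono fun ω => ?_
          simp only [hF, MDP.behaviorPolicy]
          rw [Finset.sum_congr rfl fun x _ => (ENNReal.ofReal_mul (Real.exp_pos _).le).symm,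
            ← ENNReal.ofReal_sum_of_nonneg fun x _ =>
              mul_nonneg (Real.exp_pos _).le (softmax_pos _ _).le]
          refine ENNReal.ofReal_le_one.2 ?_
          simp only [mul_comm (Real.exp _)]
          exact hg _
      _ = 1 := by simp
  have hcoord : Measurable fun z : Fin M.horizon → S × A => F (z ⟨h, hh⟩).1 (z ⟨h, hh⟩).2 :=
    (measurable_uncurry_of_discrete hFm).comp (measurable_pi_apply _)
  have hFω : ∀ i, Measurable fun ω => F (s i h ω) (a i h ω) := fun i =>
    (measurable_uncurry_of_discrete hFm).comp
      (((tr i).measurable_state h hh).prodMk ((tr i).measurable_action h hh))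
  have hprod : ∫⁻ ω, ∏ i, F (s i h ω) (a i h ω) ∂μ ≤ 1 := by
    have hi : iIndepFun (fun i ω => F (s i h ω) (a i h ω)) μ :=
      hindep.comp (fun _ z => F (z ⟨h, hh⟩).1 (z ⟨h, hh⟩).2) fun _ => hcoord
    rw [lintegral_prod_eq_prod_lintegral_of_indepFun Finset.univ
      (fun i ω => F (s i h ω) (a i h ω)) hi hFω]
    exact Finset.prod_le_one' fun i _ => hF1 i
  have hmarkov : ENNReal.ofReal (1 / p) *
      μ {ω | ENNReal.ofReal (1 / p) ≤ ∏ i, F (s i h ω) (a i h ω)} ≤ 1 :=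
    (mul_meas_ge_le_lintegral (Finset.measurable_prod Finset.univ fun i _ => hFω i) _).trans hprod
  have hsub : {ω | Real.log (1 / p) ≤ ∑ i, g (s i h ω) (a i h ω)} ⊆
      {ω | ENNReal.ofReal (1 / p) ≤ ∏ i, F (s i h ω) (a i h ω)} := by
    intro ω hω
    simp only [Set.mem_ofPred_eq, hF] at hω ⊢
    rw [← ENNReal.ofReal_prod_of_nonneg fun i _ => (Real.exp_pos _).le, ← Real.exp_sum]
    refine ENNReal.ofReal_le_ofReal ?_
    rw [← Real.exp_log (show 0 < 1 / p by positivity)]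
    exact Real.exp_le_exp.2 hω
  refine (measure_mono hsub).trans ?_
  have hpp : ENNReal.ofReal p * ENNReal.ofReal (1 / p) = 1 := by
    rw [← ENNReal.ofReal_mul hp.le, mul_one_div_cancel hp.ne', ENNReal.ofReal_one]
  set m := μ {ω | ENNReal.ofReal (1 / p) ≤ ∏ i, F (s i h ω) (a i h ω)}
  calc m = ENNReal.ofReal p * (ENNReal.ofReal (1 / p) * m) := by rw [← mul_assoc, hpp, one_mul]
    _ ≤ ENNReal.ofReal p * 1 := by gcongr
    _ = ENNReal.ofReal p := mul_one _

/-- Likelihood ratio bound for one alternative `q`: at the observed states, the squared Hellinger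
distances between the choice probabilities of the agent and of `q` are controlled by the observed
log-likelihood ratio. -/
theorem measure_likelihood_ratio_le [DiscreteMeasurableSpace A] [Nonempty A]
    (tr : ∀ i, IsBehaviorTrajectory M γ μ (s i) (a i))
    (hindep : iIndepFun (fun i ω => past (s i) (a i) M.horizon ω) μ) {h : ℕ} (hh : h < M.horizon)
    (hQ : ∀ x, Measurable fun y => M.agentQ γ h y x) {q : S → A → ℝ}
    (hq : ∀ x, Measurable fun y => q y x) {p : ℝ} (hp : 0 < p) :
    μ {ω | Real.log (1 / p) ≤ ∑ i, hellingerLogRatio (M.agentQ γ h (s i h ω)) (q (s i h ω))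
      (a i h ω)} ≤ ENNReal.ofReal p :=
  measure_log_le_sum_le tr hindep hh hQ (measurable_hellingerLogRatio hQ hq)
    (fun _ => sum_softmax_mul_exp_half_log_le _ _) hp

/-- The noise bound for the transitions from step `h` to step `h + 1`. -/
theorem measure_transition_noise_le (tr : ∀ i, IsBehaviorTrajectory M γ μ (s i) (a i))
    (hindep : iIndepFun (fun i ω => past (s i) (a i) M.horizon ω) μ) {h : ℕ}
    (hh : h + 1 < M.horizon) {d : ℕ} (hd : 0 < d) {V : S → ℝ} (hV : Measurable V) {H : ℝ}
    (hH : 0 < H) (hVH : ∀ y, V y ∈ Set.Icc 0 H) {v : S × A → EuclideanSpace ℝ (Fin d)}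
    (hv : Measurable v) {p : ℝ} (hp : 0 < p) (hp1 : p ≤ 1) :
    μ {ω | (fun i => ((s i h ω, a i h ω), s i (h + 1) ω)) ∈ noiseEvent (M.trans h) V v n
      (Real.sqrt d * (H * Real.sqrt (Real.log (2 * d / p))))} ≤ ENNReal.ofReal p := by
  have := M.isMarkov h
  have hcoord : Measurable fun z : Fin M.horizon → S × A =>
      (z ⟨h, by omega⟩, (z ⟨h + 1, hh⟩).1) :=
    (measurable_pi_apply _).prodMk (measurable_fst.comp (measurable_pi_apply _))
  exact measure_noiseEvent_le hd hV hH hVH hv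
    (fun i => (((tr i).measurable_state h (by omega)).prodMk
      ((tr i).measurable_action h (by omega))).prodMk ((tr i).measurable_state (h + 1) hh))
    (hindep.comp _ fun _ => hcoord) (fun i => (tr i).map_transition hh) hp hp1

end Trajectory

/-! ### Maximum likelihood estimation of the action values -/

section MaximumLikelihood

theorem LogCoverLE.exists_finset {d n : ℕ} {Θ : Set (EuclideanSpace ℝ (Fin d))} {b : ℝ}
    (hΘ : LogCoverLE Θ (1 / (n : ℝ≥0)) b) (hne : Θ.Nonempty) :
    ∃ T : Finset (EuclideanSpace ℝ (Fin d)), T.Nonempty ∧ (∀ θ ∈ T, θ ∈ Θ) ∧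
      Real.log T.card ≤ b ∧ ∀ θ ∈ Θ, ∃ θ' ∈ T, ∀ x : EuclideanSpace ℝ (Fin d), ‖x‖ ≤ 1 →
        |inner ℝ x θ - inner ℝ x θ'| ≤ 2 * Real.sqrt d / n := by
  obtain ⟨N, hN, hlog⟩ := hΘ
  set Θ' := (fun θ : EuclideanSpace ℝ (Fin d) => (θ.ofLp : Fin d → ℝ)) '' Θ
  have h1 : Metric.coveringNumber (2 * (1 / (n : ℝ≥0))) Θ' ≤ (N : ℕ∞) :=
    (Metric.coveringNumber_two_mul_le_externalCoveringNumber _ _).trans hN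
  obtain ⟨C, hC, hfin, hcov, hcard⟩ := Metric.exists_set_encard_eq_coveringNumber
    (ne_top_of_le_ne_top (ENat.natCast_ne_top N) h1)
  have hCne : C.Nonempty := hcov.nonempty (hne.image _)
  have hinj : Function.Injective (WithLp.toLp 2 : (Fin d → ℝ) → EuclideanSpace ℝ (Fin d)) :=
    WithLp.toLp_injective 2
  refine ⟨hfin.toFinset.map ⟨_, hinj⟩, ?_, ?_, ?_, ?_⟩
  · simpa using hCne
  · intro θ hθ
    obtain ⟨c, hc, rfl⟩ := Finset.mem_map.1 hθ
    obtain ⟨θ', hθ', rfl⟩ := hC (hfin.mem_toFinset.1 hc)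
    exact hθ'
  · refine le_trans ?_ hlog
    rw [Finset.card_map]
    have h2 : ((hfin.toFinset.card : ℕ) : ℕ∞) ≤ N := by
      rw [← hfin.encard_eq_coe_toFinset_card, hcard]
      exact h1
    refine Real.log_le_log ?_ (by exact_mod_cast h2)
    exact_mod_cast Finset.card_pos.2 (hfin.toFinset_nonempty.2 hCne)
  · intro θ hθ
    obtain ⟨c, hc, hd⟩ := hcov (Set.mem_image_of_mem _ hθ)
    refine ⟨WithLp.toLp 2 c, Finset.mem_map_of_mem _ (hfin.mem_toFinset.2 hc), fun x hx => ?_⟩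
    have h2 : dist θ.ofLp c ≤ 2 / n := by
      have h3 : edist θ.ofLp c ≤ ((2 * (1 / (n : ℝ≥0)) : ℝ≥0) : ℝ≥0∞) := hd
      rw [edist_le_coe, ← NNReal.coe_le_coe, coe_nndist] at h3
      refine h3.trans (le_of_eq ?_)
      push_cast
      ring
    have h4 : ‖θ - WithLp.toLp 2 c‖ ≤ Real.sqrt d * (2 / n) := by
      rw [EuclideanSpace.norm_eq, ← Real.sqrt_sq (show (0 : ℝ) ≤ 2 / n by positivity),
        ← Real.sqrt_mul (Nat.cast_nonneg d)]
      refine Real.sqrt_le_sqrt ?_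
      calc _ ≤ ∑ _j : Fin d, (2 / (n : ℝ)) ^ 2 := by
            refine Finset.sum_le_sum fun j _ => ?_
            refine pow_le_pow_left₀ (norm_nonneg _) ?_ 2
            exact (dist_le_pi_dist θ.ofLp c j).trans h2
        _ = d * (2 / (n : ℝ)) ^ 2 := by simp
    rw [← inner_sub_right]
    calc _ ≤ ‖x‖ * ‖θ - WithLp.toLp 2 c‖ := abs_real_inner_le_norm _ _
      _ ≤ 1 * (Real.sqrt d * (2 / n)) := mul_le_mul hx h4 (norm_nonneg _) zero_le_one
      _ = 2 * Real.sqrt d / n := by ring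

variable {S A : Type*} [Fintype A] {d n : ℕ}

theorem logLik_eq (φ : S → A → EuclideanSpace ℝ (Fin d)) (s : Fin n → S) (a : Fin n → A)
    (θ : EuclideanSpace ℝ (Fin d)) :
    logLik φ s a θ = (1 / (n : ℝ)) * ∑ i, Real.log (softmax (linFun φ θ (s i)) (a i)) := by
  simp only [logLik, log_softmax]

/-- In-sample accuracy of the maximum likelihood estimate. On the event of the likelihood ratio
bound for a finite cover `T`, the estimated and the true action values are close at the observed
states, for all actions at once. -/
theorem IsMLE.exists_sum_sq_le (hn : 0 < n) {φ : S → A → EuclideanSpace ℝ (Fin d)}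
    {Θ : Set (EuclideanSpace ℝ (Fin d))} {a₀ : A} (hφ0 : ∀ y, φ y a₀ = 0) {H : ℝ}
    (hΘ : ∀ θ ∈ Θ, ∀ y x, linFun φ θ y x ∈ Set.Icc 0 H) (hφ : ∀ y x, ‖φ y x‖ ≤ 1)
    {T : Finset (EuclideanSpace ℝ (Fin d))} (hTΘ : ∀ θ ∈ T, θ ∈ Θ)
    (hT : ∀ θ ∈ Θ, ∃ θ' ∈ T, ∀ x : EuclideanSpace ℝ (Fin d), ‖x‖ ≤ 1 →
      |inner ℝ x θ - inner ℝ x θ'| ≤ 2 * Real.sqrt d / n)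
    {s : Fin n → S} {a : Fin n → A} {θ₀ θ₁ : EuclideanSpace ℝ (Fin d)} (hθ₀ : θ₀ ∈ Θ)
    (hθ₁ : IsMLE φ Θ s a θ₁) {L : ℝ}
    (hL : ∀ θ ∈ T, ∑ i, hellingerLogRatio (linFun φ θ₀ (s i)) (linFun φ θ (s i)) (a i) ≤ L) :
    ∃ D : Fin n → ℝ, (∀ i, 0 ≤ D i) ∧
      (∀ i x, |linFun φ θ₁ (s i) x - linFun φ θ₀ (s i) x| ≤ D i) ∧
      ∑ i, D i ^ 2 ≤ 8 * d / n + 64 * (Fintype.card A * Real.exp H) * (2 * Real.sqrt d + L) := by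
  have : Nonempty A := ⟨a₀⟩
  have hn' : (0 : ℝ) < n := by exact_mod_cast hn
  obtain ⟨θ', hθ'T, hθ'⟩ := hT θ₁ hθ₁.1
  set e := 2 * Real.sqrt d / n with he
  have he0 : 0 ≤ e := by positivity
  set K := Fintype.card A * Real.exp H with hK
  have hK0 : 0 ≤ K := by positivity
  have hclose : ∀ i x, |linFun φ θ₁ (s i) x - linFun φ θ' (s i) x| ≤ e := fun i x =>
    hθ' _ (hφ _ _)
  have haff0 : ∀ i, 0 ≤ 1 - softmaxAffinity (linFun φ θ₀ (s i)) (linFun φ θ' (s i)) := fun i =>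
    one_sub_softmaxAffinity_nonneg _ _
  have haff : ∑ i, (1 - softmaxAffinity (linFun φ θ₀ (s i)) (linFun φ θ' (s i))) ≤
      2 * Real.sqrt d + L := by
    have h1 := hL θ' hθ'T
    simp only [hellingerLogRatio] at h1
    rw [Finset.sum_add_distrib, ← Finset.sum_div, Finset.sum_sub_distrib] at h1
    have h2 : ∑ i, Real.log (softmax (linFun φ θ₀ (s i)) (a i)) ≤
        ∑ i, Real.log (softmax (linFun φ θ₁ (s i)) (a i)) := by
      have := hθ₁.2 hθ₀
      simp only [Set.mem_ofPred_eq, logLik_eq] at this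
      exact le_of_mul_le_mul_left this (by positivity)
    have h3 : ∑ i, Real.log (softmax (linFun φ θ₁ (s i)) (a i)) -
        ∑ i, Real.log (softmax (linFun φ θ' (s i)) (a i)) ≤ 4 * Real.sqrt d := by
      rw [← Finset.sum_sub_distrib]
      calc _ ≤ ∑ _i : Fin n, 2 * e := Finset.sum_le_sum fun i _ =>
            (le_abs_self _).trans (abs_log_softmax_sub_le (hclose i) (a i))
        _ = 4 * Real.sqrt d := by
            rw [Finset.sum_const, Finset.card_univ, Fintype.card_fin, nsmul_eq_mul, he]
            field_simp
            ring
    linarith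
  refine ⟨fun i => e + Real.sqrt (32 * K *
    (1 - softmaxAffinity (linFun φ θ₀ (s i)) (linFun φ θ' (s i)))), fun i => by positivity,
    fun i x => ?_, ?_⟩
  · have h1 : |linFun φ θ' (s i) x - linFun φ θ₀ (s i) x| ≤ Real.sqrt (32 * K *
        (1 - softmaxAffinity (linFun φ θ₀ (s i)) (linFun φ θ' (s i)))) := by
      refine Real.abs_le_sqrt (sq_sub_le_one_sub_softmaxAffinity (a₀ := a₀) (hΘ θ₀ hθ₀ _)
        (hΘ θ' (hTΘ θ' hθ'T) _) ?_ ?_ x)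
      · simp [linFun, hφ0]
      · simp [linFun, hφ0]
    exact (abs_sub_le _ (linFun φ θ' (s i) x) _).trans (add_le_add (hclose i x) h1)
  · calc _ ≤ ∑ i, (2 * e ^ 2 + 64 * K *
          (1 - softmaxAffinity (linFun φ θ₀ (s i)) (linFun φ θ' (s i)))) := by
          refine Finset.sum_le_sum fun i _ => ?_
          have h1 := Real.sq_sqrt (mul_nonneg (mul_nonneg (by norm_num : (0 : ℝ) ≤ 32) hK0)
            (haff0 i))
          nlinarith [sq_nonneg (e - Real.sqrt (32 * K *
            (1 - softmaxAffinity (linFun φ θ₀ (s i)) (linFun φ θ' (s i)))))]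
      _ = 8 * d / n + 64 * K *
          ∑ i, (1 - softmaxAffinity (linFun φ θ₀ (s i)) (linFun φ θ' (s i))) := by
          rw [Finset.sum_add_distrib, Finset.mul_sum, Finset.sum_const, Finset.card_univ,
            Fintype.card_fin, nsmul_eq_mul, he, div_pow, mul_pow, Real.sq_sqrt (Nat.cast_nonneg d)]
          congr 1
          field_simp
          ring
      _ ≤ _ := by gcongr

end MaximumLikelihood

/-! ### Comparison of the error terms -/

section Constants

theorem log_pow_three_le {n : ℝ} (hn : 1 ≤ n) : Real.log n ^ 3 ≤ 216 * Real.sqrt n := by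
  have hx := Real.log_nonneg hn
  have h1 : Real.log n / 6 ≤ Real.exp (Real.log n / 6) := by
    linarith [Real.add_one_le_exp (Real.log n / 6)]
  have h2 := pow_le_pow_left₀ (by positivity) h1 3
  have h3 : Real.exp (Real.log n / 6) ^ 3 = Real.sqrt n := by
    rw [← Real.exp_nat_mul, ← Real.exp_log (Real.sqrt_pos.2 (by linarith : 0 < n)),
      Real.log_sqrt (by linarith)]
    congr 1
    push_cast
    ring
  rw [h3] at h2
  nlinarith

/-- The metric entropy enters through `log n`, while the bound only offers the regularization `lam`
and `l = log (n H / (lam δ))`. If `log n ≤ a`, the term with `a ^ 2` dominates. Otherwise `H` and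
`a` are below `log n`, and either `n H / lam ≥ √n`, so that `l` dominates `log n`, or `lam ≥ H √n`,
which dominates `H (log n) ^ 3`. -/
theorem entropy_term_le {n H a lam l : ℝ} (hn : 1 ≤ n) (hH : 1 ≤ H) (hHa : H ≤ a)
    (hlam : 0 < lam) (hl1 : 1 ≤ l) (hl : Real.log (n * H / lam) ≤ l) :
    H ^ 2 * a * Real.log n ≤ 216 * (lam + H ^ 2 * a ^ 2 * l) := by
  have ha : 1 ≤ a := hH.trans hHa
  have hx := Real.log_nonneg hn
  have hn0 : 0 < n := by linarith
  have hHa2 : 0 ≤ H ^ 2 * a := by positivity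
  have hll : H ^ 2 * a * a * 1 ≤ H ^ 2 * a * a * l := by gcongr
  rcases le_or_gt (Real.log n) a with h1 | h1
  · nlinarith [mul_le_mul_of_nonneg_left h1 hHa2]
  have hsn : 0 < Real.sqrt n := Real.sqrt_pos.2 hn0
  rcases le_or_gt (Real.sqrt n) (n * H / lam) with h2 | h2
  · have h3 : Real.log n ≤ 2 * l := by
      have := Real.log_le_log hsn h2
      rw [Real.log_sqrt hn0.le] at this
      linarith
    have h4 := mul_le_mul_of_nonneg_left h3 hHa2
    have h5 : H ^ 2 * a * 1 * l ≤ H ^ 2 * a * a * l := by gcongr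
    nlinarith
  · have h3 : H * Real.sqrt n ≤ lam := by
      rw [div_lt_iff₀ hlam] at h2
      have := Real.mul_self_sqrt hn0.le
      refine le_of_mul_le_mul_left ?_ hsn
      nlinarith
    have h4 : H ^ 2 * a * Real.log n ≤ H * Real.log n ^ 3 := by
      have : H * a ≤ Real.log n * Real.log n := by
        apply mul_le_mul (hHa.trans h1.le) h1.le (by linarith) hx
      have := mul_le_mul_of_nonneg_left this (mul_nonneg (by linarith : 0 ≤ H) hx)
      nlinarith
    have h5 := mul_le_mul_of_nonneg_left (log_pow_three_le hn) (by linarith : 0 ≤ H)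
    have h6 : 0 ≤ H ^ 2 * a ^ 2 * l := by positivity
    nlinarith

theorem noise_term_le {d H a δ l : ℝ} (hd : 1 ≤ d) (hH : 1 ≤ H) (hHa : H ≤ a) (hδ : 0 < δ)
    (hl1 : 1 ≤ l) (hl : Real.log (1 / δ) ≤ l) :
    Real.sqrt d * (H * Real.sqrt (Real.log (2 * d / (δ / (2 * H))))) ≤
      3 * (H * a * d * Real.sqrt l) := by
  have ha : 1 ≤ a := hH.trans hHa
  have h1 : Real.log (2 * d / (δ / (2 * H))) ≤ 9 * (a * a * d * l) := by
    have e : 2 * d / (δ / (2 * H)) = 4 * d * H * (1 / δ) := by field_simp; ring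
    rw [e, Real.log_mul (by positivity) (by positivity), Real.log_mul (by positivity) (by positivity)]
    have h2 := Real.log_le_sub_one_of_pos (show 0 < 4 * d by linarith)
    have h3 := Real.log_le_sub_one_of_pos (show 0 < H by linarith)
    have h4 : 1 ≤ a * a := by nlinarith
    have h5 : a ≤ a * a := by nlinarith
    have h6 : a * a ≤ a * a * d := le_mul_of_one_le_right (by positivity) hd
    have h7 : a * a * d ≤ a * a * d * l := le_mul_of_one_le_right (by positivity) hl1
    have h8 : 1 * d ≤ a * a * d := by gcongr
    have h9 : 1 * l ≤ a * a * d * l := by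
      have : 1 ≤ a * a * d := h4.trans h6
      gcongr
    linarith
  have h2 : Real.sqrt d * Real.sqrt (Real.log (2 * d / (δ / (2 * H)))) ≤ 3 * (a * d * Real.sqrt l) := by
    rw [← Real.sqrt_mul (by linarith)]
    refine Real.sqrt_le_iff.2 ⟨by positivity, ?_⟩
    have e : (3 * (a * d * Real.sqrt l)) ^ 2 = d * (9 * (a * a * d * l)) := by
      rw [mul_pow, mul_pow, mul_pow, Real.sq_sqrt (by linarith)]; ring
    rw [e]
    exact mul_le_mul_of_nonneg_left h1 (by linarith)
  calc _ = H * (Real.sqrt d * Real.sqrt (Real.log (2 * d / (δ / (2 * H))))) := by ring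
    _ ≤ H * (3 * (a * d * Real.sqrt l)) := mul_le_mul_of_nonneg_left h2 (by linarith)
    _ = _ := by ring

theorem estimation_term_le {n d H a lam δ l c t : ℝ} (hn : 1 ≤ n) (hd : 1 ≤ d) (hH : 1 ≤ H)
    (hHa : H ≤ a) (hlam : 0 < lam) (hδ : 0 < δ) (hc : 0 ≤ c) (hl1 : 1 ≤ l)
    (hl : Real.log (n * H / lam) ≤ l) (hlδ : Real.log (1 / δ) ≤ l) (ht1 : 1 ≤ t)
    (ht : Real.log t ≤ c * d * Real.log n) :
    H * Real.sqrt (8 * d / n + 64 * a * (2 * Real.sqrt d + Real.log (1 / (δ / (2 * H * t))))) ≤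
      8 * Real.sqrt (6 + 216 * c) * (Real.sqrt (lam * d) + H * a * d * Real.sqrt l) := by
  have ha : 1 ≤ a := hH.trans hHa
  have hx := Real.log_nonneg hn
  have hG : 8 * d / n + 64 * a * (2 * Real.sqrt d + Real.log (1 / (δ / (2 * H * t)))) ≤
      64 * (6 * (a * a * d * l) + c * d * (a * Real.log n)) := by
    have e : 1 / (δ / (2 * H * t)) = t * (2 * H) * (1 / δ) := by field_simp
    rw [e, Real.log_mul (by positivity) (by positivity), Real.log_mul (by positivity) (by positivity)]
    have h1 := Real.log_le_sub_one_of_pos (show 0 < 2 * H by linarith)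
    have h2 : Real.sqrt d ≤ d := by
      rw [Real.sqrt_le_left (by linarith)]
      nlinarith
    have h3 : 8 * d / n ≤ 8 * d := div_le_self (by linarith) hn
    have h4 : a * d ≤ a * d * l := le_mul_of_one_le_right (by positivity) hl1
    have h5 : 1 * l ≤ a * d * l := by
      have : 1 ≤ a * d := by nlinarith
      gcongr
    have h6 : 1 * d ≤ a * d := by gcongr
    have h7 : a * 1 ≤ a * d := by gcongr
    have h8 : 2 * Real.sqrt d + (Real.log t + Real.log (2 * H) + Real.log (1 / δ)) ≤
        5 * (a * d * l) + c * d * Real.log n := by linarith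
    have h9 := mul_le_mul_of_nonneg_left h8 (show 0 ≤ 64 * a by linarith)
    have h10 : 1 * (a * d * l) ≤ a * (a * d * l) := by gcongr
    nlinarith
  have hs : 0 ≤ H * a * d * Real.sqrt l := by positivity
  have hs2 : 0 ≤ Real.sqrt (lam * d) := Real.sqrt_nonneg _
  calc _ ≤ H * Real.sqrt (64 * (6 * (a * a * d * l) + c * d * (a * Real.log n))) := by gcongr
    _ = Real.sqrt (H ^ 2 * (64 * (6 * (a * a * d * l) + c * d * (a * Real.log n)))) := by
        rw [Real.sqrt_mul (sq_nonneg H), Real.sqrt_sq (by linarith)]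
    _ ≤ _ := by
        refine Real.sqrt_le_iff.2 ⟨by positivity, ?_⟩
        have h1 := entropy_term_le hn hH hHa hlam hl1 hl
        have h2 := mul_le_mul_of_nonneg_left h1 (show 0 ≤ c * d by positivity)
        have h3 : H ^ 2 * a ^ 2 * l * d ≤ H ^ 2 * a ^ 2 * l * d * d :=
          le_mul_of_one_le_right (by positivity) hd
        have e1 : (8 * Real.sqrt (6 + 216 * c) *
            (Real.sqrt (lam * d) + H * a * d * Real.sqrt l)) ^ 2 =
            64 * (6 + 216 * c) * (Real.sqrt (lam * d) + H * a * d * Real.sqrt l) ^ 2 := by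
          rw [mul_pow, mul_pow, Real.sq_sqrt (by positivity)]; norm_num
        have e2 : lam * d + H ^ 2 * a ^ 2 * l * d * d ≤
            (Real.sqrt (lam * d) + H * a * d * Real.sqrt l) ^ 2 := by
          have a1 := Real.sq_sqrt (show 0 ≤ lam * d by positivity)
          have a2 : (H * a * d * Real.sqrt l) ^ 2 = H ^ 2 * a ^ 2 * l * d * d := by
            rw [mul_pow, Real.sq_sqrt (by linarith)]; ring
          nlinarith [mul_nonneg hs2 hs]
        rw [e1]
        have h4 : 0 ≤ lam * d := by positivity
        calc _ = 64 * (6 * (H ^ 2 * a ^ 2 * l * d) + c * d * (H ^ 2 * a * Real.log n)) := by ring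
          _ ≤ 64 * (6 * (H ^ 2 * a ^ 2 * l * d) +
              c * d * (216 * (lam + H ^ 2 * a ^ 2 * l))) := by linarith
          _ = 64 * ((6 + 216 * c) * (H ^ 2 * a ^ 2 * l * d) + 216 * c * (lam * d)) := by ring
          _ ≤ 64 * ((6 + 216 * c) * (H ^ 2 * a ^ 2 * l * d * d) + (6 + 216 * c) * (lam * d)) := by
              have := mul_le_mul_of_nonneg_left h3 (show 0 ≤ 6 + 216 * c by positivity)
              linarith
          _ = 64 * (6 + 216 * c) * (lam * d + H ^ 2 * a ^ 2 * l * d * d) := by ring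
          _ ≤ _ := mul_le_mul_of_nonneg_left e2 (by positivity)

end Constants

/-! ### The good event and the error bound -/

theorem MDP.agentV_eq_softmaxValue {S A : Type*} [MeasurableSpace S] [MeasurableSpace A]
    [Fintype A] (M : MDP S A) (γ : ℝ) {h : ℕ} (hh : h < M.horizon) (y : S) :
    M.agentV γ h y = softmaxValue (M.agentQ γ h y) :=
  M.agentV_eq γ hh y

section Main

variable {Ω S A : Type*} [MeasurableSpace Ω] [MeasurableSpace S] [MeasurableSpace A] [Fintype A]
  [DiscreteMeasurableSpace A] {M : MDP S A} {γ : ℝ} {μ : Measure Ω} [IsProbabilityMeasure μ]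
  {d n : ℕ}

theorem measurableSet_le_sum_hellingerLogRatio {p q : S → A → ℝ}
    (hp : ∀ x, Measurable fun y => p y x) (hq : ∀ x, Measurable fun y => q y x) (r : ℝ)
    {s : Fin n → Ω → S} {a : Fin n → Ω → A} (hs : ∀ i, Measurable (s i))
    (ha : ∀ i, Measurable (a i)) :
    MeasurableSet {ω | r ≤ ∑ i, hellingerLogRatio (p (s i ω)) (q (s i ω)) (a i ω)} := by
  have h1 : Measurable fun z : S × A => hellingerLogRatio (p z.1) (q z.1) z.2 :=
    measurable_uncurry_of_discrete (f := fun y x => hellingerLogRatio (p y) (q y) x)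
      (measurable_hellingerLogRatio hp hq)
  have h2 : ∀ i, Measurable fun ω => hellingerLogRatio (p (s i ω)) (q (s i ω)) (a i ω) :=
    fun i => h1.comp ((hs i).prodMk (ha i))
  exact measurableSet_le measurable_const (Finset.measurable_sum _ fun i _ => h2 i)

/-- The likelihood ratio bound for all elements of `T` and the transition noise bound hold at all
steps with probability at least `1 - δ`, by a union bound. -/
theorem exists_good_event [Nonempty A] {s : Fin n → ℕ → Ω → S} {a : Fin n → ℕ → Ω → A}
    (tr : ∀ i, IsBehaviorTrajectory M γ μ (s i) (a i))
    (hindep : iIndepFun (fun i ω => past (s i) (a i) M.horizon ω) μ) (hH : 0 < M.horizon)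
    (hd : 0 < d) {φ : S → A → EuclideanSpace ℝ (Fin d)} (hφ : ∀ x, Measurable fun y => φ y x)
    (hQ : ∀ h, h < M.horizon → ∀ x, Measurable fun y => M.agentQ γ h y x)
    (hQH : ∀ h, h < M.horizon → ∀ y x, M.agentQ γ h y x ∈ Set.Icc (0 : ℝ) M.horizon)
    {T : Finset (EuclideanSpace ℝ (Fin d))} (hT : T.Nonempty) {δ : ℝ} (hδ : 0 < δ) (hδ1 : δ < 1) :
    ∃ E : Set Ω, MeasurableSet E ∧ ENNReal.ofReal (1 - δ) ≤ μ E ∧ ∀ ω ∈ E, ∀ h, h < M.horizon →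
      (∀ θ ∈ T, ∑ i, hellingerLogRatio (M.agentQ γ h (s i h ω)) (linFun φ θ (s i h ω))
        (a i h ω) ≤ Real.log (1 / (δ / (2 * M.horizon * T.card)))) ∧
      (h + 1 < M.horizon → (fun i => ((s i h ω, a i h ω), s i (h + 1) ω)) ∉
        noiseEvent (M.trans h) (M.agentV γ (h + 1)) (fun z : S × A => φ z.1 z.2) n
          (Real.sqrt d * (M.horizon *
            Real.sqrt (Real.log (2 * d / (δ / (2 * M.horizon))))))) := by
  have hH' : (1 : ℝ) ≤ M.horizon := by exact_mod_cast hH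
  have hT' : (0 : ℝ) < T.card := by exact_mod_cast hT.card_pos
  set p := δ / (2 * M.horizon * T.card) with hp
  set p' := δ / (2 * M.horizon) with hp'
  have hp0 : 0 < p := by positivity
  have hp0' : 0 < p' := by positivity
  have hlin : ∀ θ x, Measurable fun y => linFun φ θ y x := fun θ x => (hφ x).inner_const
  set B₁ : ℕ → EuclideanSpace ℝ (Fin d) → Set Ω := fun h θ => {ω | Real.log (1 / p) ≤
    ∑ i, hellingerLogRatio (M.agentQ γ h (s i h ω)) (linFun φ θ (s i h ω)) (a i h ω)} with hB₁
  set B₂ : ℕ → Set Ω := fun h => {ω | h + 1 < M.horizon ∧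
    (fun i => ((s i h ω, a i h ω), s i (h + 1) ω)) ∈
      noiseEvent (M.trans h) (M.agentV γ (h + 1)) (fun z : S × A => φ z.1 z.2) n
        (Real.sqrt d * (M.horizon * Real.sqrt (Real.log (2 * d / p'))))} with hB₂
  set B : ℕ → Set Ω := fun h => (⋃ θ ∈ T, B₁ h θ) ∪ B₂ h with hB
  have hV : ∀ h, h < M.horizon → Measurable (M.agentV γ h) := by
    intro h hh
    rw [funext fun y => M.agentV_eq_softmaxValue γ hh y]
    exact Finset.measurable_sum _ fun x _ => (measurable_softmax (hQ h hh) x).mul (hQ h hh x)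
  have hVH : ∀ h, h < M.horizon → ∀ y, M.agentV γ h y ∈ Set.Icc (0 : ℝ) M.horizon := by
    intro h hh y
    rw [M.agentV_eq_softmaxValue γ hh y]
    exact softmaxValue_mem_Icc (hQH h hh y) (Nat.cast_nonneg _)
  have hφ' : Measurable fun z : S × A => φ z.1 z.2 := measurable_uncurry_of_discrete hφ
  have hm₁ : ∀ h, h < M.horizon → ∀ θ, MeasurableSet (B₁ h θ) := by
    intro h hh θ
    exact measurableSet_le_sum_hellingerLogRatio (p := M.agentQ γ h) (q := linFun φ θ) (hQ h hh)
      (hlin θ) _ (fun i => (tr i).measurable_state h hh) fun i => (tr i).measurable_action h hh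
  have hm₂ : ∀ h, MeasurableSet (B₂ h) := by
    intro h
    by_cases hh : h + 1 < M.horizon
    · simp only [hB₂, hh, true_and]
      refine (measurableSet_noiseEvent (hV _ hh) hφ' _).preimage (measurable_pi_lambda _ fun i => ?_)
      exact (((tr i).measurable_state h (by omega)).prodMk
        ((tr i).measurable_action h (by omega))).prodMk ((tr i).measurable_state (h + 1) hh)
    · simp [hB₂, hh]
  have hm : ∀ h, h < M.horizon → MeasurableSet (B h) := fun h hh =>
    (Finset.measurableSet_biUnion _ fun θ _ => hm₁ h hh θ).union (hm₂ h)
  have hμB : ∀ h, h < M.horizon → μ (B h) ≤ ENNReal.ofReal (δ / M.horizon) := by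
    intro h hh
    have h1 : μ (⋃ θ ∈ T, B₁ h θ) ≤ ENNReal.ofReal p' := by
      refine (measure_biUnion_finset_le T _).trans ?_
      calc _ ≤ ∑ _θ ∈ T, ENNReal.ofReal p := Finset.sum_le_sum fun θ _ =>
            measure_likelihood_ratio_le (q := linFun φ θ) tr hindep hh (hQ h hh) (hlin θ) hp0
        _ = ENNReal.ofReal p' := by
            rw [Finset.sum_const, nsmul_eq_mul, ← ENNReal.ofReal_natCast,
              ← ENNReal.ofReal_mul hT'.le, hp, hp']
            congr 1
            field_simp
    have h2 : μ (B₂ h) ≤ ENNReal.ofReal p' := by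
      by_cases hh1 : h + 1 < M.horizon
      · simp only [hB₂, hh1, true_and]
        refine measure_transition_noise_le tr hindep hh1 hd (hV _ hh1) (by positivity)
          (hVH _ hh1) hφ' hp0' ?_
        rw [hp', div_le_one (by positivity)]
        linarith
      · simp [hB₂, hh1]
    refine (measure_union_le _ _).trans ((add_le_add h1 h2).trans (le_of_eq ?_))
    rw [← ENNReal.ofReal_add hp0'.le hp0'.le, hp']
    congr 1
    field_simp
    ring
  refine ⟨(⋃ h ∈ Finset.range M.horizon, B h)ᶜ, ?_, ?_, ?_⟩
  · exact (Finset.measurableSet_biUnion _ fun h hh => hm h (Finset.mem_range.1 hh)).compl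
  · rw [prob_compl_eq_one_sub
      (Finset.measurableSet_biUnion _ fun h hh => hm h (Finset.mem_range.1 hh)),
      ENNReal.ofReal_sub _ hδ.le, ENNReal.ofReal_one]
    refine tsub_le_tsub_left ?_ 1
    refine (measure_biUnion_finset_le _ _).trans ?_
    calc _ ≤ ∑ _h ∈ Finset.range M.horizon, ENNReal.ofReal (δ / M.horizon) :=
          Finset.sum_le_sum fun h hh => hμB h (Finset.mem_range.1 hh)
      _ = ENNReal.ofReal δ := by
          rw [Finset.sum_const, Finset.card_range, nsmul_eq_mul, ← ENNReal.ofReal_natCast,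
            ← ENNReal.ofReal_mul (Nat.cast_nonneg _)]
          congr 1
          field_simp
  · intro ω hω h hh
    have hnot : ω ∉ B h := fun hc =>
      hω (Set.mem_biUnion (Finset.mem_coe.2 (Finset.mem_range.2 hh)) hc)
    refine ⟨fun θ hθ => ?_, fun hh1 hc => hnot (Or.inr ⟨hh1, hc⟩)⟩
    by_contra hc
    exact hnot (Or.inl (Set.mem_biUnion (Finset.mem_coe.2 hθ) (not_le.1 hc).le))

/-- Correlation of the design with a vector that is small in `ℓ²`. -/
theorem abs_sum_mul_inner_le {v : Fin n → EuclideanSpace ℝ (Fin d)} {lam : ℝ} (hlam : 0 < lam)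
    {e D : Fin n → ℝ} (he : ∀ i, |e i| ≤ D i) (u : EuclideanSpace ℝ (Fin d)) :
    |∑ i, e i * inner ℝ (v i) u| ≤
      Real.sqrt (∑ i, D i ^ 2) * Real.sqrt (ridgeEnergy v lam u) := by
  calc |∑ i, e i * inner ℝ (v i) u| ≤ ∑ i, D i * |inner ℝ (v i) u| := by
        refine (Finset.abs_sum_le_sum_abs _ _).trans (Finset.sum_le_sum fun i _ => ?_)
        rw [abs_mul]
        exact mul_le_mul_of_nonneg_right (he i) (abs_nonneg _)
    _ ≤ Real.sqrt (∑ i, D i ^ 2) * Real.sqrt (∑ i, |inner ℝ (v i) u| ^ 2) :=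
        Real.sum_mul_le_sqrt_mul_sqrt _ _ _
    _ ≤ _ := by
        simp only [sq_abs]
        exact mul_le_mul_of_nonneg_left
          (Real.sqrt_le_sqrt (sum_sq_inner_le_ridgeEnergy hlam u)) (Real.sqrt_nonneg _)

/-- Correlation of a design of vectors of norm at most one with residuals bounded by `b`; useful
when `lam` is at least of the order of `n`. -/
theorem sum_mul_inner_le_of_abs_le {v : Fin n → EuclideanSpace ℝ (Fin d)} {lam b : ℝ}
    (hlam : 0 < lam) (hb : 0 ≤ b) (hv : ∀ i, ‖v i‖ ≤ 1) {e : Fin n → ℝ} (he : ∀ i, |e i| ≤ b)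
    (u : EuclideanSpace ℝ (Fin d)) :
    ∑ i, e i * inner ℝ (v i) u ≤ n * b / Real.sqrt lam * Real.sqrt (ridgeEnergy v lam u) := by
  have hs := Real.sqrt_pos.2 hlam
  calc ∑ i, e i * inner ℝ (v i) u ≤ ∑ _i : Fin n, b * ‖u‖ := by
        refine Finset.sum_le_sum fun i _ => (le_abs_self _).trans ?_
        rw [abs_mul]
        refine mul_le_mul (he i) ?_ (abs_nonneg _) hb
        exact (abs_real_inner_le_norm _ _).trans (mul_le_of_le_one_left (norm_nonneg _) (hv i))
    _ = n * b / Real.sqrt lam * (Real.sqrt lam * ‖u‖) := by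
        rw [Finset.sum_const, Finset.card_univ, Fintype.card_fin, nsmul_eq_mul]
        field_simp
    _ ≤ _ := mul_le_mul_of_nonneg_left (sqrt_mul_norm_le_sqrt_ridgeEnergy hlam u) (by positivity)

end Main

theorem theorem2 (c : ℝ) : ∃ C : ℝ, 0 < C ∧
    ∀ (S : Type*) (A : Type*) (Ω : Type*) [MeasurableSpace S] [Fintype A] [MeasurableSpace A]
      [DiscreteMeasurableSpace A] [MeasurableSpace Ω] (μ : Measure Ω) [IsProbabilityMeasure μ]
      -- the decision process, the agent's discount factor, the linear model class
      (M : MDP S A) (γ : ℝ) (_ : 0 ≤ γ) (_ : γ ≤ 1)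
      (d : ℕ) (_ : 0 < d) (φ : S → A → EuclideanSpace ℝ (Fin d))
      (_ : ∀ a, Measurable fun s => φ s a)
      (Θ : Set (EuclideanSpace ℝ (Fin d)))
      (a₀ : A) (_ : ∀ s, φ s a₀ = 0)
      (_ : ∀ θ ∈ Θ, ∀ s a, linFun φ θ s a ∈ Set.Icc (0 : ℝ) M.horizon)
      -- the model class contains the action values and the reward
      (_ : ∀ h, h < M.horizon → ∃ θ ∈ Θ, ∀ s a, M.agentQ γ h s a = linFun φ θ s a)
      (_ : ∀ h, h < M.horizon →
        ∃ w ∈ Θ, ‖w‖ ≤ Real.sqrt d ∧ ∀ s a, M.reward h s a = linFun φ w s a)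
      -- regularity conditions
      (_ : ∀ θ ∈ Θ, ‖θ‖ ≤ M.horizon * Real.sqrt d)
      (_ : ∀ s a, ‖φ s a‖ ≤ 1)
      (n : ℕ) (_ : 0 < n)
      (_ : LogCoverLE Θ (1 / (n : ℝ≥0)) (c * d * Real.log n))
      -- the data: `n` independent trajectories of the agent
      (s : Fin n → ℕ → Ω → S) (a : Fin n → ℕ → Ω → A)
      (_ : ∀ i, IsBehaviorTrajectory M γ μ (s i) (a i))
      (_ : iIndepFun (fun i ω => past (s i) (a i) M.horizon ω) μ)
      (δ : ℝ) (_ : 0 < δ) (_ : δ < 1),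
      ∃ E : Set Ω, MeasurableSet E ∧ ENNReal.ofReal (1 - δ) ≤ μ E ∧
        ∀ ω ∈ E,
          -- the maximum likelihood estimates of all steps
          ∀ θhat : ℕ → EuclideanSpace ℝ (Fin d),
          (∀ h, h < M.horizon →
            IsMLE φ Θ (fun i => s i h ω) (fun i => a i h ω) (θhat h)) →
          ∀ h, h < M.horizon → ∀ lam : ℝ, 0 < lam →
          -- the ridge regression estimate of the reward parameter
          ∀ what : EuclideanSpace ℝ (Fin d),
          IsMinOn (bellmanLoss M.horizon γ lam φ θhat h (fun i => s i h ω) (fun i => a i h ω)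
            (fun i => s i (h + 1) ω)) Set.univ what →
          ∀ (x : S) (y : A),
            |M.reward h x y - linFun φ what x y| ≤
              matNorm (gramMatrix φ (fun i => s i h ω) (fun i => a i h ω) +
                lam • (1 : Matrix (Fin d) (Fin d) ℝ))⁻¹ (φ x y) *
              (C * (Real.sqrt (lam * d) +
                (1 + γ) * (M.horizon * Real.exp M.horizon) * (Fintype.card A : ℝ) * d *
                  Real.sqrt (Real.log (n * M.horizon / (lam * δ))))) := by
  set c' := max c 0 with hc'
  have hc0 : 0 ≤ c' := le_max_right _ _
  set C := 80 * Real.sqrt (6 + 216 * c') + 10 with hC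
  refine ⟨C, by positivity, ?_⟩
  intro S A Ω _ _ _ _ _ μ _ M γ hγ0 hγ1 d hd φ hφm Θ a₀ hφ0 hΘH hQΘ hrΘ _ hφ1 n hn hcov s a tr
    hindep δ hδ hδ1
  rcases Nat.eq_zero_or_pos M.horizon with hH0 | hH
  · exact ⟨Set.univ, MeasurableSet.univ, by simp [hδ.le], fun ω _ θ _ h hh => absurd hh (by omega)⟩
  have : Nonempty A := ⟨a₀⟩
  have hH1 : (1 : ℝ) ≤ M.horizon := by exact_mod_cast hH
  have hd1 : (1 : ℝ) ≤ d := by exact_mod_cast hd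
  have hn1 : (1 : ℝ) ≤ n := by exact_mod_cast hn
  obtain ⟨T, hTne, hTΘ, hTcard, hT⟩ := hcov.exists_finset ((hQΘ 0 hH).imp fun _ h => h.1)
  have hT1 : (1 : ℝ) ≤ T.card := by exact_mod_cast hTne.card_pos
  have hTcard' : Real.log T.card ≤ c' * d * Real.log n := by
    refine hTcard.trans ?_
    have := Real.log_nonneg hn1
    gcongr
    exact le_max_left _ _
  have hQH : ∀ h, h < M.horizon → ∀ y x, M.agentQ γ h y x ∈ Set.Icc (0 : ℝ) M.horizon := by
    intro h hh y x
    obtain ⟨θ, hθ, hθQ⟩ := hQΘ h hh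
    rw [hθQ]
    exact hΘH θ hθ y x
  have hQm : ∀ h, h < M.horizon → ∀ x, Measurable fun y => M.agentQ γ h y x := by
    intro h hh x
    obtain ⟨θ, hθ, hθQ⟩ := hQΘ h hh
    simp only [hθQ]
    exact (hφm x).inner_const
  obtain ⟨E, hE, hμE, hgood⟩ := exists_good_event tr hindep hH hd hφm hQm hQH hTne hδ hδ1
  refine ⟨E, hE, hμE, fun ω hω θhat hmle h hh lam hlam what hwhat x y => ?_⟩
  obtain ⟨w, -, hwn, hwr⟩ := hrΘ h hh
  set H : ℝ := (M.horizon : ℝ) with hHdef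
  set v : Fin n → EuclideanSpace ℝ (Fin d) := fun i => φ (s i h ω) (a i h ω) with hv
  set K := (Fintype.card A : ℝ) * Real.exp H with hK
  have hcardA : (1 : ℝ) ≤ Fintype.card A := by exact_mod_cast Fintype.card_pos
  have hHK : H ≤ K := by
    have h1 := Real.add_one_le_exp H
    have h2 : Real.exp H ≤ K := le_mul_of_one_le_left (Real.exp_pos _).le hcardA
    linarith
  set G := 8 * (d : ℝ) / n + 64 * K *
    (2 * Real.sqrt d + Real.log (1 / (δ / (2 * H * T.card)))) with hG
  -- in-sample accuracy of the estimated action values at every step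
  have hfit : ∀ k, k < M.horizon → ∃ D : Fin n → ℝ, (∀ i, 0 ≤ D i) ∧
      (∀ i b, |linFun φ (θhat k) (s i k ω) b - M.agentQ γ k (s i k ω) b| ≤ D i) ∧
      ∑ i, D i ^ 2 ≤ G := by
    intro k hk
    obtain ⟨θ, hθ, hθQ⟩ := hQΘ k hk
    have hθQ' : M.agentQ γ k = linFun φ θ := funext₂ hθQ
    rw [hθQ']
    refine (hmle k hk).exists_sum_sq_le hn hφ0 hΘH hφ1 hTΘ hT hθ fun θ' hθ' => ?_
    rw [← hθQ']
    exact (hgood ω hω k hk).1 θ' hθ'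
  have hVhat : ∀ k y, estV M.horizon φ θhat k y ∈ Set.Icc 0 H := by
    intro k y
    rw [estV]
    split_ifs with hk
    · exact softmaxValue_mem_Icc (hΘH _ (hmle k hk).1 y) (by positivity)
    · exact ⟨le_rfl, by positivity⟩
  set ε : Fin n → ℝ := fun i => linFun φ (θhat h) (s i h ω) (a i h ω) -
    γ * estV M.horizon φ θhat (h + 1) (s i (h + 1) ω) - M.reward h (s i h ω) (a i h ω) with hε
  have hmin : IsMinOn (fun u => ∑ i, (inner ℝ (v i) u - (inner ℝ (v i) w + ε i)) ^ 2 +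
      lam * ‖u‖ ^ 2) Set.univ what := by
    convert hwhat using 1
    funext u
    rw [bellmanLoss]
    congr 1
    refine Finset.sum_congr rfl fun i _ => ?_
    simp only [hε, hwr, linFun, hv]
    ring
  set l := Real.log (n * H / (lam * δ)) with hl
  set P := H * K * d * Real.sqrt l with hP
  have hP0 : 0 ≤ P := by positivity
  have hlamd : Real.sqrt lam * ‖w‖ ≤ Real.sqrt (lam * d) := by
    rw [Real.sqrt_mul hlam.le]
    exact mul_le_mul_of_nonneg_left hwn (Real.sqrt_nonneg _)
  -- it suffices to bound the residual functional
  have main : ∀ B, 0 ≤ B → (∀ u, ∑ i, ε i * inner ℝ (v i) u ≤ B * Real.sqrt (ridgeEnergy v lam u)) →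
      B ≤ (C - 1) * (Real.sqrt (lam * d) + (1 + γ) * P) →
      |M.reward h x y - linFun φ what x y| ≤
        matNorm (gramMatrix φ (fun i => s i h ω) (fun i => a i h ω) +
          lam • (1 : Matrix (Fin d) (Fin d) ℝ))⁻¹ (φ x y) *
        (C * (Real.sqrt (lam * d) + (1 + γ) * (H * Real.exp H) * (Fintype.card A : ℝ) * d *
          Real.sqrt l)) := by
    intro B hB0 hB hBC
    rw [hwr]
    refine (abs_inner_sub_le_of_isMinOn hlam hB0 hmin hB (φ x y)).trans ?_
    refine mul_le_mul_of_nonneg_left ?_ (Real.sqrt_nonneg _)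
    have e : (1 + γ) * (H * Real.exp H) * (Fintype.card A : ℝ) * d * Real.sqrt l =
        (1 + γ) * P := by rw [hP, hK]; ring
    rw [e]
    have : 0 ≤ (1 + γ) * P := by positivity
    linarith
  have hsC : 0 ≤ Real.sqrt (6 + 216 * c') := Real.sqrt_nonneg _
  rcases le_or_gt (n * H) (4 * lam) with hreg | hreg
  · -- strong regularization: the residuals are bounded by `2 H`
    refine main (n * (2 * H) / Real.sqrt lam) (by positivity)
      (sum_mul_inner_le_of_abs_le hlam (by positivity) (fun i => hφ1 _ _) fun i => ?_) ?_
    · have h1 := hΘH _ (hmle h hh).1 (s i h ω) (a i h ω)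
      have h2 := hVhat (h + 1) (s i (h + 1) ω)
      have h3 := M.reward_mem h hh (s i h ω) (a i h ω)
      have h4 : γ * estV M.horizon φ θhat (h + 1) (s i (h + 1) ω) ≤ 1 * H :=
        mul_le_mul hγ1 h2.2 h2.1 zero_le_one
      have h5 := mul_nonneg hγ0 h2.1
      rw [abs_le]
      constructor <;> linarith [h1.1, h1.2, h3.1, h3.2]
    · have h1 : n * (2 * H) / Real.sqrt lam ≤ 8 * Real.sqrt lam := by
        rw [div_le_iff₀ (Real.sqrt_pos.2 hlam), mul_assoc, Real.mul_self_sqrt hlam.le]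
        linarith
      have h2 : Real.sqrt lam ≤ Real.sqrt (lam * d) :=
        Real.sqrt_le_sqrt (le_mul_of_one_le_right hlam.le hd1)
      have h3 : 0 ≤ (1 + γ) * P := by positivity
      have h4 : 0 ≤ Real.sqrt (lam * d) := Real.sqrt_nonneg _
      nlinarith [mul_nonneg hsC h4, mul_nonneg hsC h3]
  -- weak regularization: here `l ≥ 1` and `l` dominates `log (1 / δ)`
  have hK4 : 4 ≤ n * H / lam := by rw [le_div_iff₀ hlam]; exact hreg.le
  have hlsplit : l = Real.log (n * H / lam) + Real.log (1 / δ) := by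
    rw [hl, ← Real.log_mul (by positivity) (by positivity)]
    congr 1
    field_simp
  have hlogδ : 0 ≤ Real.log (1 / δ) := Real.log_nonneg (by rw [le_div_iff₀ hδ]; linarith)
  have hlogK : 1 ≤ Real.log (n * H / lam) := by
    refine le_trans ?_ (Real.log_le_log (by norm_num) hK4)
    rw [show (4 : ℝ) = 2 ^ 2 by norm_num, Real.log_pow]
    have := Real.log_two_gt_d9
    push_cast
    linarith
  have hest := estimation_term_le hn1 hd1 hH1 hHK hlam hδ hc0 (by linarith : 1 ≤ l)
    (by linarith) (by linarith) hT1 hTcard'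
  have hnoi := noise_term_le hd1 hH1 hHK hδ (by linarith : 1 ≤ l) (by linarith)
  rw [← hG] at hest
  set W := Real.sqrt d * (H * Real.sqrt (Real.log (2 * d / (δ / (2 * H))))) with hW
  have hW0 : 0 ≤ W := by positivity
  have hGs : 0 ≤ Real.sqrt G := Real.sqrt_nonneg _
  refine main (Real.sqrt G + γ * ((1 + 4 * H) * Real.sqrt G + W)) (by positivity) ?_ ?_
  · intro u
    have hEs : 0 ≤ Real.sqrt (ridgeEnergy v lam u) := Real.sqrt_nonneg _
    obtain ⟨D, hD0, hD, hDG⟩ := hfit h hh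
    have h1 : ∑ i, (linFun φ (θhat h) (s i h ω) (a i h ω) -
        M.agentQ γ h (s i h ω) (a i h ω)) * inner ℝ (v i) u ≤
        Real.sqrt G * Real.sqrt (ridgeEnergy v lam u) := by
      refine (le_abs_self _).trans ((abs_sum_mul_inner_le hlam (fun i => hD i _) u).trans ?_)
      exact mul_le_mul_of_nonneg_right (Real.sqrt_le_sqrt hDG) hEs
    have h2 : -∑ i, (estV M.horizon φ θhat (h + 1) (s i (h + 1) ω) -
        ∫ y', M.agentV γ (h + 1) y' ∂(M.trans h (s i h ω, a i h ω))) * inner ℝ (v i) u ≤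
        ((1 + 4 * H) * Real.sqrt G + W) * Real.sqrt (ridgeEnergy v lam u) := by
      by_cases hh1 : h + 1 < M.horizon
      · obtain ⟨D', hD0', hD', hDG'⟩ := hfit (h + 1) hh1
        have h3 : |∑ i, (estV M.horizon φ θhat (h + 1) (s i (h + 1) ω) -
            M.agentV γ (h + 1) (s i (h + 1) ω)) * inner ℝ (v i) u| ≤
            (1 + 4 * H) * Real.sqrt G * Real.sqrt (ridgeEnergy v lam u) := by
          refine (abs_sum_mul_inner_le (D := fun i => (1 + 4 * H) * D' i) hlam (fun i => ?_)
            u).trans ?_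
          · rw [estV, if_pos hh1, M.agentV_eq_softmaxValue γ hh1]
            exact abs_softmaxValue_sub_le (hQH _ hh1 _) (hD0' i) (by positivity) (hD' i)
          · refine mul_le_mul_of_nonneg_right ?_ hEs
            simp only [mul_pow]
            rw [← Finset.mul_sum, Real.sqrt_mul (sq_nonneg _), Real.sqrt_sq (by positivity)]
            gcongr
        have h4 := (hgood ω hω h hh).2 hh1
        simp only [noiseEvent, Set.mem_ofPred_eq, not_exists, not_lt] at h4
        have h5 := h4 (-u)
        simp only [inner_neg_right, neg_sq, mul_neg, Finset.sum_neg_distrib] at h5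
        have h6 : W * Real.sqrt (∑ i, inner ℝ (v i) u ^ 2) ≤
            W * Real.sqrt (ridgeEnergy v lam u) :=
          mul_le_mul_of_nonneg_left
            (Real.sqrt_le_sqrt (sum_sq_inner_le_ridgeEnergy hlam u)) hW0
        have h7 : ∑ i, (estV M.horizon φ θhat (h + 1) (s i (h + 1) ω) -
            ∫ y', M.agentV γ (h + 1) y' ∂(M.trans h (s i h ω, a i h ω))) * inner ℝ (v i) u =
            ∑ i, (estV M.horizon φ θhat (h + 1) (s i (h + 1) ω) -
              M.agentV γ (h + 1) (s i (h + 1) ω)) * inner ℝ (v i) u +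
            ∑ i, (M.agentV γ (h + 1) (s i (h + 1) ω) -
              ∫ y', M.agentV γ (h + 1) y' ∂(M.trans h (s i h ω, a i h ω))) *
                inner ℝ (v i) u := by
          rw [← Finset.sum_add_distrib]
          exact Finset.sum_congr rfl fun i _ => by ring
        rw [h7]
        linarith [(abs_le.1 h3).1]
      · -- at the last step both value functions vanish
        have hlast : h + 1 = M.horizon := by omega
        have h3 : ∀ y', M.agentV γ (h + 1) y' = 0 := fun y' => by
          rw [hlast]; exact M.agentV_horizon γ y'
        simp only [estV, if_neg hh1, h3, integral_zero, sub_zero, zero_mul, Finset.sum_const_zero,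
          neg_zero]
        positivity
    have h3 : ∑ i, ε i * inner ℝ (v i) u = ∑ i, (linFun φ (θhat h) (s i h ω) (a i h ω) -
        M.agentQ γ h (s i h ω) (a i h ω)) * inner ℝ (v i) u +
        γ * -∑ i, (estV M.horizon φ θhat (h + 1) (s i (h + 1) ω) -
          ∫ y', M.agentV γ (h + 1) y' ∂(M.trans h (s i h ω, a i h ω))) * inner ℝ (v i) u := by
      rw [← Finset.sum_neg_distrib, Finset.mul_sum, ← Finset.sum_add_distrib]
      refine Finset.sum_congr rfl fun i _ => ?_
      simp only [hε, MDP.agentQ]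
      ring
    rw [h3]
    have h4 := mul_le_mul_of_nonneg_left h2 hγ0
    linarith
  · have hR : 0 ≤ Real.sqrt (lam * d) := Real.sqrt_nonneg _
    have h1 : Real.sqrt G + γ * ((1 + 4 * H) * Real.sqrt G + W) ≤
        5 * (1 + γ) * (H * Real.sqrt G) + γ * W := by
      have a1 : Real.sqrt G ≤ H * Real.sqrt G := le_mul_of_one_le_left hGs hH1
      have a2 := mul_le_mul_of_nonneg_left a1 hγ0
      have a3 : 0 ≤ γ * (H * Real.sqrt G) := by positivity
      linarith
    have h2 := mul_le_mul_of_nonneg_left hest (show 0 ≤ 5 * (1 + γ) by positivity)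
    have h3 := mul_le_mul_of_nonneg_left hnoi hγ0
    have h4 : (1 + γ) * (Real.sqrt (6 + 216 * c') * Real.sqrt (lam * d)) ≤
        2 * (Real.sqrt (6 + 216 * c') * Real.sqrt (lam * d)) :=
      mul_le_mul_of_nonneg_right (by linarith) (mul_nonneg hsC hR)
    have h5 : γ * P ≤ (1 + γ) * P := mul_le_mul_of_nonneg_right (by linarith) hP0
    have h6 : 0 ≤ (1 + γ) * P := by positivity
    have h7 := mul_nonneg hsC h6
    rw [← hP] at h2 h3
    rw [hC]
    linarith
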